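/- Let $0<\lambda_0<\lambda_1<\lambda_2<\cdots$ be a sequence of real numbers, and put $I_j=[\lambda_{2j-1},\lambda_{2j}]$, $d_j=\lambda_{2j}-\lambda_{2j-1}$ $(j\ge 1)$, $h_{ij}=\operatorname{dist}(I_i,I_j)$ $(i,j\ge1)$, $h_{0k}=\lambda_{2k-1}-\lambda_0$. Assume (H1) $\lim_i\lambda_i=\lambda_*<\infty$; (H2) $\sum_{j\ge1} d_j<\infty$; (H3) $\sup_{j}\sum_{k\ge1,\,k\ne j}\sqrt{d_k}/h_{jk}<\infty$. Let $p,\mathcal M:\mathbb R\times\mathbb R\to\mathbb R$, $(t,x)\mapsto p(t,x),\mathcal M(t,x)$, be such that for constants $0<\delta\le\Delta$ and $B$, and every $t$, the functions $p(t,\cdot)$ and $\mathcal M(t,\cdot)$ are uniformly continuous and differentiable with $\delta\le p\le B$, $\delta\le\mathcal M\le\Delta$, and such that $\alpha=\sup_{t,x}\left|\frac{p_x}{p}-\frac{\mathcal M_x}{\mathcal M}\right|<\infty$. Let $c_i$ $(i\ge 1)$ be a circle over the gap $I_i$ with angular coordinate $\theta_i$, whose points project to $P_i=(\lambda_{2i-1}-\lambda_{2i})\sin^2(\theta_i/2)+\lambda_{2i}\in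 I_i$. For $g\ge0$ put $k_g(0^+)=\sqrt{\lambda_0\lambda_1\cdots\lambda_{2g}}$, and for a point of $c_i$ with $1\le i\le g$ let $k_g(P_i)$ be the square root of $-\prod_{l=0}^{2g}(P_i-\lambda_l)$ which is positive for $\theta_i\in(0,\pi)$ and negative for $\theta_i\in(\pi,2\pi)$; so $k_g(P_i)=\frac{d_i}{2}\sin\theta_i\cdot\kappa_{g,i}$ with $\kappa_{g,i}=\sqrt{P_i-\lambda_0}\prod_{1\le j\le g,\,j\ne i}\sqrt{(P_i-\lambda_{2j-1})(P_i-\lambda_{2j})}>0$. Fix for every $t\in\mathbb R$ and $i\ge1$ an initial point on $c_i$. For each $g$ and $t$ let $P_1^{(g)}(t,x),\dots,P_g^{(g)}(t,x)$ be the pole motion on $c_1\times\cdots\times c_g$ which has these initial points at $x=0$ and solves $$P^{(g)}_{i,x}=\frac{-\mathcal M\,k_g(P_i^{(g)})\prod_{l=1}^gP_l^{(g)}}{p\,k_g(0^+)\prod_{j\ne i}(P_j^{(g)}-P_i^{(g)})},$$ understood in the angular coordinates, i.e. as $$\theta^{(g)}_{i,x}=\frac{\mathcal M\,\kappa_{g,i}\prod_{l=1}^gP_l^{(g)}}{p\,k_g(0^+)\prod_{j\ne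 i}(P_j^{(g)}-P_i^{(g)})},\qquad i=1,\dots,g.$$ With $E_n(z)=\exp(z+z^2/2+\dots+z^n/n)$, put for $\lambda\in G=\mathbb C\setminus\{\lambda_*\}$ $$U_g(t,x,\lambda)=\frac{-2p(t,x)\,k_g(0^+)}{\mathcal M(t,x)\prod_{i=1}^gP_i^{(g)}(t,x)}\prod_{i=1}^g\frac{\lambda-P_i^{(g)}(t,x)}{\lambda-\lambda_*}\,E_i\!\left(\frac{\lambda_*-\lambda_{2i}}{\lambda_*-\lambda}\right).$$ Then: (1) For every compact $K\subset G$ there is a constant $C$ such that, for all $g\ge 0$, $(t,x)\in\mathbb R^2$ and $\lambda\in K$, $U_g$ is differentiable in $x$ at $(t,x,\lambda)$ and $|U_{g,x}(t,x,\lambda)|\le C$. (2) The limits $P_i(t,x)=\lim_{g\to\infty}P_i^{(g)}(t,x)$ exist, the infinite products in $$U(t,x,\lambda)=-\frac{2\sqrt{\lambda_0}\,p(t,x)}{\mathcal M(t,x)}\prod_{k=1}^\infty\frac{\sqrt{\lambda_{2k-1}\lambda_{2k}}}{P_k(t,x)}\prod_{i=1}^\infty\frac{\lambda-P_i(t,x)}{\lambda-\lambda_*}\,E_i\!\left(\frac{\lambda_*-\lambda_{2i}}{\lambda_*-\lambda}\right)$$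 converge for all $(t,x)\in\mathbb R^2$ and $\lambda\in G$, and for all compact $K\subset G$ and $X\subset\mathbb R$ one has $U_g(t,x,\lambda)\to U(t,x,\lambda)$ as $g\to\infty$, uniformly in $t\in\mathbb R$, $x\in X$ and $\lambda\in K$. -/

import Mathlib

noncomputable section

namespace SL

open Filter Topology

/-- Length `d_j = λ_{2j} - λ_{2j-1}` of the `j`-th gap `I_j = [λ_{2j-1}, λ_{2j}]`, `j ≥ 1`. -/
def gapLen (lam : ℕ → ℝ) (j : ℕ) : ℝ := lam (2 * j) - lam (2 * j - 1)

/-- For an increasing sequence `lam` this is `h_{ij} = dist (I_i, I_j)` when `i ≠ j`, `i, j ≥ 1`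
(see `gapDist_isLeast`), and `h_{0k} = λ_{2k-1} - λ_0` when `i = 0`, `k ≥ 1`. -/
def gapDist (lam : ℕ → ℝ) (i j : ℕ) : ℝ :=
  if i < j then lam (2 * j - 1) - lam (2 * i) else lam (2 * i - 1) - lam (2 * j)

/-- The assumptions on the sequence `0 < λ_0 < λ_1 < ⋯` clustering at the finite point `λ_*`. -/
structure Admissible (lam : ℕ → ℝ) (lamStar : ℝ) : Prop where
  pos : 0 < lam 0
  strictMono : StrictMono lam
  H1 : Tendsto lam atTop (𝓝 lamStar)
  H2 : Summable fun j : ℕ => gapLen lam (j + 1)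
  H3_summable : ∀ j : ℕ,
    Summable fun k : {k : ℕ // 1 ≤ k ∧ k ≠ j} => √(gapLen lam k) / gapDist lam j k
  H3_bdd : BddAbove (Set.range fun j : ℕ =>
    ∑' k : {k : ℕ // 1 ≤ k ∧ k ≠ j}, √(gapLen lam k) / gapDist lam j k)

/-- The class of pairs `(p, 𝓜)` of uniformly continuous functions with
`p ≥ δ` and `δ ≤ 𝓜 ≤ Δ`. -/
structure MemE2 (δ Δ : ℝ) (p M : ℝ → ℝ) : Prop where
  p_uc : UniformContinuous p
  M_uc : UniformContinuous M
  p_lower : ∀ x, δ ≤ p x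
  M_lower : ∀ x, δ ≤ M x
  M_upper : ∀ x, M x ≤ Δ

/-- The projection to the gap `I_i` of the point with angular coordinate `ϑ` on the circle `c_i`
lying over `I_i`: `P = (λ_{2i-1} - λ_{2i}) sin² (ϑ / 2) + λ_{2i}`. -/
def pole (lam : ℕ → ℝ) (i : ℕ) (ϑ : ℝ) : ℝ :=
  (lam (2 * i - 1) - lam (2 * i)) * Real.sin (ϑ / 2) ^ 2 + lam (2 * i)

/-- `k_g(0⁺)`, the positive square root of `λ_0 λ_1 ⋯ λ_{2g}`. -/
def kZero (lam : ℕ → ℝ) (g : ℕ) : ℝ := √(∏ j ∈ Finset.range (2 * g + 1), lam j)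

/-- The value at the point of `c_i` with angle `ϑ` of the function `k_g` on the Riemann surface of
`w² = -(λ - λ_0) ⋯ (λ - λ_{2g})`: the square root which is positive for `ϑ ∈ (0, π)` and negative
for `ϑ ∈ (π, 2π)`. -/
def kAt (lam : ℕ → ℝ) (g i : ℕ) (ϑ : ℝ) : ℝ :=
  Real.sign (Real.sin ϑ) * √(-∏ j ∈ Finset.range (2 * g + 1), (pole lam i ϑ - lam j))

/-- The positive factor of `k_g` on `c_i` which remains after removing `(d_i / 2) sin ϑ`
(see `kAt_eq`). -/
def kReg (lam : ℕ → ℝ) (g i : ℕ) (ϑ : ℝ) : ℝ :=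
  √(pole lam i ϑ - lam 0) * ∏ j ∈ (Finset.Icc 1 g).erase i,
    √((pole lam i ϑ - lam (2 * j - 1)) * (pole lam i ϑ - lam (2 * j)))

/-- The pole motion on the product of the circles `c_1, …, c_g`, written in the angular
coordinates: `θ i x` is the angle of the `i`-th point at `x`, and `θ₀ i` its angle at `x = 0`.
The projected points `P_i = pole lam i (θ i x)` solve
`P_i' = - 𝓜 k_g(P_i) ∏ P_l / (p k_g(0⁺) ∏_{j ≠ i} (P_j - P_i))`, see
`IsPoleMotion.hasDerivAt_pole`; the angular form is this equation on the circles, without the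
degeneracy at the two ends of a gap, where `k_g` vanishes. -/
structure IsPoleMotion (lam : ℕ → ℝ) (g : ℕ) (p M : ℝ → ℝ) (θ₀ : ℕ → ℝ) (θ : ℕ → ℝ → ℝ) :
    Prop where
  init : ∀ i ∈ Finset.Icc 1 g, θ i 0 = θ₀ i
  ode : ∀ i ∈ Finset.Icc 1 g, ∀ x : ℝ, HasDerivAt (θ i)
    (M x * kReg lam g i (θ i x) * (∏ l ∈ Finset.Icc 1 g, pole lam l (θ l x)) /
      (p x * kZero lam g *
        ∏ j ∈ (Finset.Icc 1 g).erase i, (pole lam j (θ j x) - pole lam i (θ i x)))) x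

/-- The convergence factor `E_n(z) = exp (z + z²/2 + ⋯ + zⁿ/n)`. -/
def E (n : ℕ) (z : ℂ) : ℂ := Complex.exp (∑ m ∈ Finset.Icc 1 n, z ^ m / (m : ℂ))

/-- The `i`-th factor `(z - P) / (z - λ_*) · E_i ((λ_* - λ_{2i}) / (λ_* - z))`. -/
def factor (lam : ℕ → ℝ) (lamStar : ℝ) (i : ℕ) (P : ℝ) (z : ℂ) : ℂ :=
  (z - (P : ℂ)) / (z - (lamStar : ℂ)) *
    E i (((lamStar : ℂ) - (lam (2 * i) : ℂ)) / ((lamStar : ℂ) - z))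

/-- `U_g` as a function of the values `p`, `m = 𝓜` and `P 1, …, P g` at a point `(t, x)`, and of
the spectral variable `z`. -/
def Ug (lam : ℕ → ℝ) (lamStar : ℝ) (g : ℕ) (p m : ℝ) (P : ℕ → ℝ) (z : ℂ) : ℂ :=
  ((-2 * p * kZero lam g / (m * ∏ i ∈ Finset.Icc 1 g, P i) : ℝ) : ℂ) *
    ∏ i ∈ Finset.Icc 1 g, factor lam lamStar i (P i) z

/-- The limit function `U`, with infinite products, as a function of the values `p`, `m = 𝓜` and
`P 1, P 2, …` at a point `(t, x)`, and of the spectral variable `z`. -/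
def Ulim (lam : ℕ → ℝ) (lamStar : ℝ) (p m : ℝ) (P : ℕ → ℝ) (z : ℂ) : ℂ :=
  ((-2 * √(lam 0) * p / m *
      ∏' k : ℕ, √(lam (2 * (k + 1) - 1) * lam (2 * (k + 1))) / P (k + 1) : ℝ) : ℂ) *
    ∏' i : ℕ, factor lam lamStar (i + 1) (P (i + 1)) z

/-! Compatibility of the definitions with the usual formulas. -/

theorem gapDist_isLeast {lam : ℕ → ℝ} (h : StrictMono lam) {i j : ℕ} (hi : 1 ≤ i) (hj : 1 ≤ j)
    (hij : i ≠ j) :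
    IsLeast (Set.image2 dist (Set.Icc (lam (2 * i - 1)) (lam (2 * i)))
      (Set.Icc (lam (2 * j - 1)) (lam (2 * j)))) (gapDist lam i j) := by
  have hI : lam (2 * i - 1) ≤ lam (2 * i) := h.monotone (by omega)
  have hJ : lam (2 * j - 1) ≤ lam (2 * j) := h.monotone (by omega)
  unfold gapDist
  split_ifs with hlt
  · have hle : lam (2 * i) ≤ lam (2 * j - 1) := h.monotone (by omega)
    refine ⟨⟨lam (2 * i), ⟨hI, le_rfl⟩, lam (2 * j - 1), ⟨le_rfl, hJ⟩, ?_⟩, ?_⟩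
    · rw [Real.dist_eq, abs_sub_comm, abs_of_nonneg (by linarith)]
    · rintro _ ⟨a, ha, b, hb, rfl⟩
      rw [Real.dist_eq, abs_sub_comm]
      exact le_trans (by linarith [ha.2, hb.1]) (le_abs_self _)
  · have hle : lam (2 * j) ≤ lam (2 * i - 1) := h.monotone (by omega)
    refine ⟨⟨lam (2 * i - 1), ⟨le_rfl, hI⟩, lam (2 * j), ⟨hJ, le_rfl⟩, ?_⟩, ?_⟩
    · rw [Real.dist_eq, abs_of_nonneg (by linarith)]
    · rintro _ ⟨a, ha, b, hb, rfl⟩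
      rw [Real.dist_eq]
      exact le_trans (by linarith [ha.1, hb.2]) (le_abs_self _)

theorem prod_range_split (f : ℕ → ℝ) (g : ℕ) :
    ∏ j ∈ Finset.range (2 * g + 1), f j
      = f 0 * ∏ j ∈ Finset.Icc 1 g, (f (2 * j - 1) * f (2 * j)) := by
  induction g with
  | zero => simp
  | succ n ih =>
    rw [show 2 * (n + 1) + 1 = (2 * n + 1) + 1 + 1 by ring, Finset.prod_range_succ,
      Finset.prod_range_succ, ih, Finset.prod_Icc_succ_top (by omega)]
    rw [show 2 * (n + 1) - 1 = 2 * n + 1 by omega, show 2 * (n + 1) = 2 * n + 1 + 1 by ring]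
    ring

theorem kAt_eq {lam : ℕ → ℝ} (h : StrictMono lam) {g i : ℕ} (hi : i ∈ Finset.Icc 1 g) (ϑ : ℝ) :
    kAt lam g i ϑ = gapLen lam i / 2 * Real.sin ϑ * kReg lam g i ϑ := by
  have hi1 : 1 ≤ i := (Finset.mem_Icc.1 hi).1
  have hd : 0 ≤ gapLen lam i := sub_nonneg.2 (h.monotone (by omega))
  have hs : Real.sin ϑ = 2 * Real.sin (ϑ / 2) * Real.cos (ϑ / 2) := by
    rw [← Real.sin_two_mul]; ring_nf
  have hsc := Real.sin_sq_add_cos_sq (ϑ / 2)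
  have hP1 : pole lam i ϑ - lam (2 * i - 1) = gapLen lam i * Real.cos (ϑ / 2) ^ 2 := by
    unfold pole gapLen
    linear_combination (lam (2 * i - 1) - lam (2 * i)) * hsc
  have hP2 : pole lam i ϑ - lam (2 * i) = -(gapLen lam i * Real.sin (ϑ / 2) ^ 2) := by
    unfold pole gapLen; ring
  have hlo : lam (2 * i - 1) ≤ pole lam i ϑ := by
    have := mul_nonneg hd (sq_nonneg (Real.cos (ϑ / 2))); linarith
  have hhi : pole lam i ϑ ≤ lam (2 * i) := by
    have := mul_nonneg hd (sq_nonneg (Real.sin (ϑ / 2))); linarith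
  have h0 : 0 ≤ pole lam i ϑ - lam 0 := by
    have : lam 0 ≤ lam (2 * i - 1) := h.monotone (by omega)
    linarith
  have hfac : ∀ j ∈ (Finset.Icc 1 g).erase i,
      0 ≤ (pole lam i ϑ - lam (2 * j - 1)) * (pole lam i ϑ - lam (2 * j)) := by
    intro j hj
    have hji := Finset.ne_of_mem_erase hj
    have hj1 : 1 ≤ j := (Finset.mem_Icc.1 (Finset.mem_of_mem_erase hj)).1
    rcases lt_or_gt_of_ne hji with hlt | hlt
    · have h1 : lam (2 * j) ≤ lam (2 * i - 1) := h.monotone (by omega)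
      have h2 : lam (2 * j - 1) ≤ lam (2 * i - 1) := h.monotone (by omega)
      exact mul_nonneg (by linarith) (by linarith)
    · have h1 : lam (2 * i) ≤ lam (2 * j - 1) := h.monotone (by omega)
      have h2 : lam (2 * i) ≤ lam (2 * j) := h.monotone (by omega)
      exact mul_nonneg_of_nonpos_of_nonpos (by linarith) (by linarith)
  have key : -∏ j ∈ Finset.range (2 * g + 1), (pole lam i ϑ - lam j)
      = (gapLen lam i / 2 * Real.sin ϑ) ^ 2 * ((pole lam i ϑ - lam 0) *
        ∏ j ∈ (Finset.Icc 1 g).erase i,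
          ((pole lam i ϑ - lam (2 * j - 1)) * (pole lam i ϑ - lam (2 * j)))) := by
    rw [prod_range_split (fun j => pole lam i ϑ - lam j), ← Finset.mul_prod_erase _ _ hi, hP1, hP2,
      hs]
    ring
  unfold kAt kReg
  rw [key, Real.sqrt_mul (sq_nonneg _), Real.sqrt_sq_eq_abs, Real.sqrt_mul h0,
    Real.sqrt_prod _ hfac, abs_mul, abs_of_nonneg (by positivity : 0 ≤ gapLen lam i / 2)]
  have hsg : Real.sign (Real.sin ϑ) * |Real.sin ϑ| = Real.sin ϑ := by
    rcases lt_trichotomy (Real.sin ϑ) 0 with hn | hz | hp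
    · rw [Real.sign_of_neg hn, abs_of_neg hn]; ring
    · rw [hz]; simp
    · rw [Real.sign_of_pos hp, abs_of_pos hp]; ring
  linear_combination (gapLen lam i / 2 * (√(pole lam i ϑ - lam 0) *
    ∏ j ∈ (Finset.Icc 1 g).erase i,
      √((pole lam i ϑ - lam (2 * j - 1)) * (pole lam i ϑ - lam (2 * j))))) * hsg

theorem IsPoleMotion.hasDerivAt_pole {lam : ℕ → ℝ} (h : StrictMono lam) {g : ℕ} {p M : ℝ → ℝ}
    {θ₀ : ℕ → ℝ} {θ : ℕ → ℝ → ℝ} (hθ : IsPoleMotion lam g p M θ₀ θ) {i : ℕ}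
    (hi : i ∈ Finset.Icc 1 g) (x : ℝ) :
    HasDerivAt (fun x => pole lam i (θ i x))
      (-M x * kAt lam g i (θ i x) * (∏ l ∈ Finset.Icc 1 g, pole lam l (θ l x)) /
        (p x * kZero lam g *
          ∏ j ∈ (Finset.Icc 1 g).erase i, (pole lam j (θ j x) - pole lam i (θ i x)))) x := by
  have h1 := ((((hθ.ode i hi x).div_const 2).sin.pow 2).const_mul
    (lam (2 * i - 1) - lam (2 * i))).add_const (lam (2 * i))
  have hs : Real.sin (θ i x) = 2 * Real.sin (θ i x / 2) * Real.cos (θ i x / 2) := by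
    rw [← Real.sin_two_mul]; ring_nf
  refine h1.congr_deriv ?_
  rw [kAt_eq h hi, hs]
  unfold gapLen
  simp only [Nat.cast_ofNat, Nat.add_one_sub_one, pow_one]
  ring

end SL

end

/-!
The angular velocity of the `i`-th of `g` poles is `𝓜 / p` times `speed lam g i P`, a product of
positive factors and a constant sign (`speed_eq`). All estimates are made for its logarithm
`logSpeed`, a sum of interactions `pairLog` of the pole with the other gaps and of terms `soloLog`.

Each interaction with the `j`-th gap is at most `d_j / h_{ij}`, so that the speeds are bounded
independently of `g` (`exists_logSpeed_le`). Moving the `j`-th pole changes the interaction to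
first order, with the factor `1 / h_{ij}`; moving the `i`-th pole changes it only to second order,
with the factor `d_j / h_{ij}²`, because the numerator and the denominator of the interaction
nearly cancel. The displacement of a pole is at most `d_j` times that of its angle. Measuring angles
in the norm `sup_i √d_i |θ_i|`, the pole displacements are `√d_j` times the norm, and the third
assumption on the gaps makes the vector field Lipschitz with a constant that does not depend on
`g` (`abs_logSpeed_sub_le`).

Passing from `g` to `g' > g` gaps multiplies the `i`-th speed by interactions with the new gaps.
Their sum need not be small uniformly in `i ≤ g`, but `√d_i` times it is, since
`√d_i / h_{ij}` is bounded: it is at most a constant times `∑_{j > g} d_j`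
(`sqrt_mul_abs_logSpeed_sub_le`). Grönwall's inequality in the weighted norm therefore gives
`|P_i^{(g)} - P_i^{(g')}| ≤ √d_i · e^{K|x|} ∑_{j > g} d_j` (`exists_abs_pole_sub_le`), so the poles
converge, and the differences are summable over `i` because `∑ √d_i` converges.

The factors of both products in `U_g` differ from `1` by summable amounts, uniformly in the poles
and for `z` away from `λ_*`: for the second product this is Weierstrass' estimate for `E_n`
together with `|P_i - λ_{2i}| ≤ d_i` (`exists_factor_bounds`). Hence all partial products are
bounded, and their differences are bounded by the sum of the differences of the factors
(`norm_prod_sub_tprod_le`). This gives the convergence `U_g → U`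
(`exists_norm_Ug_sub_Ulim_le`), and with `|∂_x P_i| ≤ const · d_i` also the bound for the derivative
(`exists_hasDerivAt_Ug`).
-/

namespace SL

open Filter Topology

/-! ### Estimates for the gaps -/

/-- The consequences of the assumptions on `lam` used below, with a single constant `C`. The sums
over `√d_k` are `H3` at index `0`, where the distances `h_{0k}` are bounded above. -/
structure GapBounds (lam : ℕ → ℝ) (C : ℝ) : Prop where
  pos : 0 < lam 0
  strictMono : StrictMono lam
  nonneg : 0 ≤ C
  sum_div : ∀ (j : ℕ) (s : Finset ℕ), (∀ k ∈ s, 1 ≤ k ∧ k ≠ j) →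
    ∑ k ∈ s, √(gapLen lam k) / gapDist lam j k ≤ C
  sum_sqrt : ∀ s : Finset ℕ, (∀ k ∈ s, 1 ≤ k) → ∑ k ∈ s, √(gapLen lam k) ≤ C
  inv_zero : 1 / lam 0 ≤ C
  inv_sub : 1 / (lam 1 - lam 0) ≤ C

/-- `P i ∈ I_i` for every `i ≥ 1`. -/
def InGaps (lam : ℕ → ℝ) (P : ℕ → ℝ) : Prop :=
  ∀ i, 1 ≤ i → lam (2 * i - 1) ≤ P i ∧ P i ≤ lam (2 * i)

section

variable {lam : ℕ → ℝ}

theorem gapLen_pos (h : StrictMono lam) {j : ℕ} (hj : 1 ≤ j) : 0 < gapLen lam j :=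
  sub_pos.2 (h (by omega))

theorem gapLen_nonneg (h : StrictMono lam) (j : ℕ) : 0 ≤ gapLen lam j :=
  sub_nonneg.2 (h.monotone (by omega))

theorem gapDist_pos (h : StrictMono lam) {i j : ℕ} (hij : i ≠ j) : 0 < gapDist lam i j := by
  unfold gapDist
  split_ifs with hlt
  · exact sub_pos.2 (h (by omega))
  · exact sub_pos.2 (h (by omega))

theorem gapDist_comm {i j : ℕ} (hij : i ≠ j) : gapDist lam i j = gapDist lam j i := by
  unfold gapDist
  rcases lt_or_gt_of_ne hij with hlt | hlt
  · rw [if_pos hlt, if_neg (by omega)]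
  · rw [if_neg (by omega), if_pos hlt]

theorem gapDist_le_abs_sub {i j : ℕ} {a b : ℝ}
    (ha : lam (2 * i - 1) ≤ a ∧ a ≤ lam (2 * i)) (hb : lam (2 * j - 1) ≤ b ∧ b ≤ lam (2 * j)) :
    gapDist lam i j ≤ |a - b| := by
  unfold gapDist
  split_ifs with hlt
  · rw [abs_sub_comm]
    exact le_trans (by linarith [ha.2, hb.1]) (le_abs_self _)
  · exact le_trans (by linarith [ha.1, hb.2]) (le_abs_self _)

theorem abs_sub_le_gapLen {j : ℕ} {a b : ℝ}
    (ha : lam (2 * j - 1) ≤ a ∧ a ≤ lam (2 * j)) (hb : lam (2 * j - 1) ≤ b ∧ b ≤ lam (2 * j)) :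
    |a - b| ≤ gapLen lam j := by
  unfold gapLen
  rw [abs_le]
  constructor <;> linarith [ha.1, ha.2, hb.1, hb.2]

theorem left_mem_gap (h : StrictMono lam) (j : ℕ) :
    lam (2 * j - 1) ≤ lam (2 * j - 1) ∧ lam (2 * j - 1) ≤ lam (2 * j) :=
  ⟨le_rfl, h.monotone (by omega)⟩

theorem right_mem_gap (h : StrictMono lam) (j : ℕ) :
    lam (2 * j - 1) ≤ lam (2 * j) ∧ lam (2 * j) ≤ lam (2 * j) :=
  ⟨h.monotone (by omega), le_rfl⟩

theorem pole_mem_gap (h : StrictMono lam) (i : ℕ) (ϑ : ℝ) :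
    lam (2 * i - 1) ≤ pole lam i ϑ ∧ pole lam i ϑ ≤ lam (2 * i) := by
  have hd := gapLen_nonneg h i
  have h1 := Real.sin_sq_le_one (ϑ / 2)
  have h2 := sq_nonneg (Real.sin (ϑ / 2))
  unfold pole
  unfold gapLen at hd
  constructor <;> nlinarith

theorem inGaps_pole (h : StrictMono lam) (ϑ : ℕ → ℝ) : InGaps lam (fun i => pole lam i (ϑ i)) :=
  fun i _ => pole_mem_gap h i (ϑ i)

theorem abs_pole_sub_pole_le (h : StrictMono lam) (i : ℕ) (a b : ℝ) :
    |pole lam i a - pole lam i b| ≤ gapLen lam i * |a - b| := by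
  have hd := gapLen_nonneg h i
  have e : pole lam i a - pole lam i b = gapLen lam i * ((Real.cos a - Real.cos b) / 2) := by
    have ha : Real.cos a = 1 - 2 * Real.sin (a / 2) ^ 2 := by
      have := Real.cos_two_mul (a / 2)
      rw [mul_div_cancel₀ _ (two_ne_zero)] at this
      linarith [Real.sin_sq_add_cos_sq (a / 2)]
    have hb : Real.cos b = 1 - 2 * Real.sin (b / 2) ^ 2 := by
      have := Real.cos_two_mul (b / 2)
      rw [mul_div_cancel₀ _ (two_ne_zero)] at this
      linarith [Real.sin_sq_add_cos_sq (b / 2)]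
    rw [ha, hb]
    unfold pole gapLen
    ring
  have hc : |Real.cos a - Real.cos b| ≤ |a - b| := by
    have := Real.abs_cos_sub_cos_le a b
    exact this
  rw [e, abs_mul, abs_of_nonneg hd]
  refine mul_le_mul_of_nonneg_left ?_ hd
  rw [abs_div, abs_two]
  linarith [abs_nonneg (Real.cos a - Real.cos b)]

theorem Admissible.exists_gapBounds {lamStar : ℝ} (h : Admissible lam lamStar) :
    ∃ C, GapBounds lam C := by
  obtain ⟨S, hS⟩ := h.H3_bdd
  have hsum : ∀ (j : ℕ) (s : Finset ℕ), (∀ k ∈ s, 1 ≤ k ∧ k ≠ j) →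
      ∑ k ∈ s, √(gapLen lam k) / gapDist lam j k ≤ S := by
    intro j s hs
    have h1 : ∑ k ∈ s, √(gapLen lam k) / gapDist lam j k
        = ∑ k ∈ s.subtype (fun k => 1 ≤ k ∧ k ≠ j), √(gapLen lam k) / gapDist lam j k := by
      rw [Finset.sum_subtype_of_mem (fun k => √(gapLen lam k) / gapDist lam j k) hs]
    rw [h1]
    refine ((h.H3_summable j).sum_le_tsum _ fun k _ => ?_).trans (hS ⟨j, rfl⟩)
    exact div_nonneg (Real.sqrt_nonneg _) (gapDist_pos h.strictMono k.2.2.symm).le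
  have hS0 : 0 ≤ S := by simpa using hsum 0 ∅ (by simp)
  have hle : ∀ n, lam n ≤ lamStar := h.strictMono.monotone.ge_of_tendsto h.H1
  have h0 := h.pos
  have h01 : lam 0 < lam 1 := h.strictMono (by norm_num)
  have hD : 0 ≤ lamStar - lam 0 := sub_nonneg.2 (hle 0)
  have p1 : 0 ≤ S * (lamStar - lam 0) := mul_nonneg hS0 hD
  have p2 : 0 ≤ 1 / lam 0 := by positivity
  have p3 : 0 ≤ 1 / (lam 1 - lam 0) := div_nonneg zero_le_one (by linarith)
  refine ⟨S + S * (lamStar - lam 0) + 1 / lam 0 + 1 / (lam 1 - lam 0), h0, h.strictMono, ?_, ?_, ?_,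
    ?_, ?_⟩
  · linarith
  · intro j s hs
    linarith [hsum j s hs]
  · intro s hs
    have h1 : ∑ k ∈ s, √(gapLen lam k)
        ≤ (∑ k ∈ s, √(gapLen lam k) / gapDist lam 0 k) * (lamStar - lam 0) := by
      rw [Finset.sum_mul]
      refine Finset.sum_le_sum fun k hk => ?_
      have hk1 := hs k hk
      have hp : 0 < gapDist lam 0 k := gapDist_pos h.strictMono (by omega)
      have hq : gapDist lam 0 k ≤ lamStar - lam 0 := by
        unfold gapDist
        rw [if_pos (by omega)]
        exact sub_le_sub_right (hle _) _
      rw [div_mul_eq_mul_div, le_div_iff₀ hp]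
      exact mul_le_mul_of_nonneg_left hq (Real.sqrt_nonneg _)
    have h2 := hsum 0 s fun k hk => ⟨hs k hk, by have := hs k hk; omega⟩
    have h3 := mul_le_mul_of_nonneg_right h2 hD
    linarith
  · linarith
  · linarith

namespace GapBounds


theorem lam_pos {C : ℝ} (hC : GapBounds lam C) (n : ℕ) : 0 < lam n :=
  hC.pos.trans_le (hC.strictMono.monotone (Nat.zero_le n))

theorem sqrt_le {C : ℝ} (hC : GapBounds lam C) {k : ℕ} (hk : 1 ≤ k) : √(gapLen lam k) ≤ C := by
  simpa using hC.sum_sqrt {k} (by simpa using hk)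

theorem sqrt_div_le {C : ℝ} (hC : GapBounds lam C) {j k : ℕ} (hk : 1 ≤ k) (hjk : k ≠ j) :
    √(gapLen lam k) / gapDist lam j k ≤ C := by
  simpa using hC.sum_div j {k} (by simpa using ⟨hk, hjk⟩)

theorem sqrt_mul_sqrt {C : ℝ} (hC : GapBounds lam C) (k : ℕ) :
    √(gapLen lam k) * √(gapLen lam k) = gapLen lam k :=
  Real.mul_self_sqrt (gapLen_nonneg hC.strictMono k)

theorem gapLen_le {C : ℝ} (hC : GapBounds lam C) {k : ℕ} (hk : 1 ≤ k) :
    gapLen lam k ≤ C * √(gapLen lam k) := by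
  calc gapLen lam k = √(gapLen lam k) * √(gapLen lam k) := (hC.sqrt_mul_sqrt k).symm
    _ ≤ C * √(gapLen lam k) := mul_le_mul_of_nonneg_right (hC.sqrt_le hk) (Real.sqrt_nonneg _)

theorem sum_gapLen_le {C : ℝ} (hC : GapBounds lam C) {s : Finset ℕ} (hs : ∀ k ∈ s, 1 ≤ k) :
    ∑ k ∈ s, gapLen lam k ≤ C * C := by
  calc ∑ k ∈ s, gapLen lam k ≤ ∑ k ∈ s, C * √(gapLen lam k) :=
        Finset.sum_le_sum fun k hk => hC.gapLen_le (hs k hk)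
    _ = C * ∑ k ∈ s, √(gapLen lam k) := by rw [Finset.mul_sum]
    _ ≤ C * C := mul_le_mul_of_nonneg_left (hC.sum_sqrt s hs) hC.nonneg

theorem sum_gapLen_div_le {C : ℝ} (hC : GapBounds lam C) (j : ℕ) {s : Finset ℕ}
    (hs : ∀ k ∈ s, 1 ≤ k ∧ k ≠ j) : ∑ k ∈ s, gapLen lam k / gapDist lam j k ≤ C * C := by
  calc ∑ k ∈ s, gapLen lam k / gapDist lam j k
      ≤ ∑ k ∈ s, C * (√(gapLen lam k) / gapDist lam j k) := by
        refine Finset.sum_le_sum fun k hk => ?_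
        rw [← mul_div_assoc]
        exact div_le_div_of_nonneg_right (hC.gapLen_le (hs k hk).1)
          (gapDist_pos hC.strictMono (hs k hk).2.symm).le
    _ = C * ∑ k ∈ s, √(gapLen lam k) / gapDist lam j k := by rw [Finset.mul_sum]
    _ ≤ C * C := mul_le_mul_of_nonneg_left (hC.sum_div j s hs) hC.nonneg

/-- With the weight `√d_i` the contribution of the gaps beyond the `g`-th one to `∑ d_k / h_{ik}`
is controlled by `∑ d_k`, uniformly in `i`; without it, `H3` gives no uniform smallness. -/
theorem sqrt_mul_sum_gapLen_div_le {C : ℝ} (hC : GapBounds lam C) {i : ℕ} (hi : 1 ≤ i)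
    {s : Finset ℕ} (hs : ∀ k ∈ s, 1 ≤ k ∧ k ≠ i) :
    √(gapLen lam i) * ∑ k ∈ s, gapLen lam k / gapDist lam i k ≤ C * ∑ k ∈ s, gapLen lam k := by
  rw [Finset.mul_sum, Finset.mul_sum]
  refine Finset.sum_le_sum fun k hk => ?_
  have h1 := hC.sqrt_div_le (j := k) hi (hs k hk).2.symm
  rw [gapDist_comm (hs k hk).2] at h1
  have h2 := mul_le_mul_of_nonneg_right h1 (gapLen_nonneg hC.strictMono k)
  calc _ = √(gapLen lam i) / gapDist lam i k * gapLen lam k := by ring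
    _ ≤ _ := h2

/-- The quadratic denominators are absorbed by `√d_i / h_{ik} ≤ C` and
`√d_k · √d_k / h_{ik} ≤ C · √d_k / h_{ik}`: this uses the half powers of the lengths in `H3`. -/
theorem sqrt_mul_sum_gapLen_div_sq_le {C : ℝ} (hC : GapBounds lam C) {i : ℕ} (hi : 1 ≤ i)
    {s : Finset ℕ} (hs : ∀ k ∈ s, 1 ≤ k ∧ k ≠ i) :
    √(gapLen lam i) * ∑ k ∈ s, gapLen lam k / gapDist lam i k ^ 2 ≤ C * C * C := by
  calc √(gapLen lam i) * ∑ k ∈ s, gapLen lam k / gapDist lam i k ^ 2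
      ≤ ∑ k ∈ s, C * C * (√(gapLen lam k) / gapDist lam i k) := by
        rw [Finset.mul_sum]
        refine Finset.sum_le_sum fun k hk => ?_
        have h1 := hC.sqrt_div_le (j := k) hi (hs k hk).2.symm
        rw [gapDist_comm (hs k hk).2] at h1
        have hp := gapDist_pos hC.strictMono (hs k hk).2.symm
        have h2 : 0 ≤ √(gapLen lam k) / gapDist lam i k := by positivity
        have h3 := mul_le_mul h1 (hC.sqrt_le (hs k hk).1) (Real.sqrt_nonneg _) hC.nonneg
        have h4 := mul_le_mul_of_nonneg_right h3 h2
        refine le_of_eq_of_le ?_ h4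
        nth_rewrite 1 [← hC.sqrt_mul_sqrt k]
        field_simp
    _ = C * C * ∑ k ∈ s, √(gapLen lam k) / gapDist lam i k := by rw [Finset.mul_sum]
    _ ≤ C * C * C :=
        mul_le_mul_of_nonneg_left (hC.sum_div i s hs) (mul_nonneg hC.nonneg hC.nonneg)

end GapBounds
end

/-! ### The logarithm of the speed of a pole -/

/-- The angular speed of the `i`-th of `g` poles at the positions `P`, for `p = 𝓜 = 1`. -/
noncomputable def speed (lam : ℕ → ℝ) (g i : ℕ) (P : ℕ → ℝ) : ℝ :=
  (√(P i - lam 0) * ∏ j ∈ (Finset.Icc 1 g).erase i,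
    √((P i - lam (2 * j - 1)) * (P i - lam (2 * j)))) * (∏ l ∈ Finset.Icc 1 g, P l) /
    (kZero lam g * ∏ j ∈ (Finset.Icc 1 g).erase i, (P j - P i))

/-- The logarithm of `√((a - λ_{2j-1}) (a - λ_{2j})) / |a - b|`, which describes the interaction of
a pole at `a` with the `j`-th gap and its pole at `b`. It is split into two terms which are each
small when `b` is close to the end points of the gap; `Real.log` takes care of the absolute
values. -/
noncomputable def pairLog (lam : ℕ → ℝ) (j : ℕ) (a b : ℝ) : ℝ :=
  (Real.log (a - lam (2 * j - 1)) - Real.log (a - b)) / 2 +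
    (Real.log (a - lam (2 * j)) - Real.log (a - b)) / 2

/-- The contribution `log (b / √(λ_{2l-1} λ_{2l}))` of a pole at `b` to all the speeds. -/
noncomputable def soloLog (lam : ℕ → ℝ) (l : ℕ) (b : ℝ) : ℝ :=
  (Real.log b - Real.log (lam (2 * l - 1))) / 2 + (Real.log b - Real.log (lam (2 * l))) / 2

/-- The logarithm of the absolute value of `speed`. -/
noncomputable def logSpeed (lam : ℕ → ℝ) (g i : ℕ) (P : ℕ → ℝ) : ℝ :=
  (Real.log (P i - lam 0) - Real.log (lam 0)) / 2 +
    ∑ l ∈ Finset.Icc 1 g, soloLog lam l (P l) +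
    ∑ j ∈ (Finset.Icc 1 g).erase i, pairLog lam j (P i) (P j)

/-- The constant sign of `speed`. -/
noncomputable def speedSign (g i : ℕ) : ℝ :=
  ∏ j ∈ (Finset.Icc 1 g).erase i, if j < i then (-1 : ℝ) else 1

theorem abs_speedSign (g i : ℕ) : |speedSign g i| = 1 := by
  unfold speedSign
  rw [Finset.abs_prod]
  refine Finset.prod_eq_one fun j _ => ?_
  split_ifs <;> simp

/-- The sign is determined by the number of gaps to the left of the `i`-th one. -/
theorem speedSign_eq {g g' i : ℕ} (hi : i ∈ Finset.Icc 1 g) (hg : g ≤ g') :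
    speedSign g' i = speedSign g i := by
  unfold speedSign
  have hsub : (Finset.Icc 1 g).erase i ⊆ (Finset.Icc 1 g').erase i :=
    Finset.erase_subset_erase i (Finset.Icc_subset_Icc le_rfl hg)
  refine (Finset.prod_subset hsub fun j hj hj' => ?_).symm
  simp only [Finset.mem_erase, Finset.mem_Icc] at hj hj' hi
  rw [if_neg]
  intro hlt
  exact hj' ⟨hj.1, hj.2.1, by omega⟩

section

variable {lam : ℕ → ℝ} {C : ℝ}

theorem sub_ne_zero_of_gap (h : StrictMono lam) {i j : ℕ} (hij : i ≠ j) {a b : ℝ}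
    (ha : lam (2 * i - 1) ≤ a ∧ a ≤ lam (2 * i)) (hb : lam (2 * j - 1) ≤ b ∧ b ≤ lam (2 * j)) :
    a - b ≠ 0 :=
  abs_pos.1 ((gapDist_pos h hij).trans_le (gapDist_le_abs_sub ha hb))

theorem exp_pairLog (h : StrictMono lam) {i j : ℕ} (hij : i ≠ j) {a b : ℝ}
    (ha : lam (2 * i - 1) ≤ a ∧ a ≤ lam (2 * i)) (hb : lam (2 * j - 1) ≤ b ∧ b ≤ lam (2 * j)) :
    Real.exp (pairLog lam j a b) =
      √((a - lam (2 * j - 1)) * (a - lam (2 * j))) / |a - b| := by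
  have h1 := sub_ne_zero_of_gap h hij ha (left_mem_gap h j)
  have h2 := sub_ne_zero_of_gap h hij ha (right_mem_gap h j)
  have h3 := sub_ne_zero_of_gap h hij ha hb
  have hpos : 0 < (a - lam (2 * j - 1)) * (a - lam (2 * j)) := by
    refine lt_of_le_of_ne ?_ (mul_ne_zero h1 h2).symm
    rcases lt_or_gt_of_ne hij with hlt | hlt
    · have e1 : lam (2 * i) ≤ lam (2 * j - 1) := h.monotone (by omega)
      have e2 : lam (2 * i) ≤ lam (2 * j) := h.monotone (by omega)
      exact mul_nonneg_of_nonpos_of_nonpos (by linarith) (by linarith)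
    · have e1 : lam (2 * j) ≤ lam (2 * i - 1) := h.monotone (by omega)
      have e2 : lam (2 * j - 1) ≤ lam (2 * i - 1) := h.monotone (by omega)
      exact mul_nonneg (by linarith) (by linarith)
  have e : pairLog lam j a b = Real.log (√((a - lam (2 * j - 1)) * (a - lam (2 * j))))
      - Real.log (a - b) := by
    rw [Real.log_sqrt hpos.le, Real.log_mul h1 h2]
    unfold pairLog
    ring
  rw [e, Real.exp_sub, Real.exp_log (Real.sqrt_pos.2 hpos), Real.exp_log_eq_abs h3]

theorem exp_soloLog (hC : GapBounds lam C) (l : ℕ) {b : ℝ} (hb : 0 < b) :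
    Real.exp (soloLog lam l b) = b / √(lam (2 * l - 1) * lam (2 * l)) := by
  have h1 := hC.lam_pos (2 * l - 1)
  have h2 := hC.lam_pos (2 * l)
  have e : soloLog lam l b = Real.log b - Real.log (√(lam (2 * l - 1) * lam (2 * l))) := by
    rw [Real.log_sqrt (by positivity), Real.log_mul h1.ne' h2.ne']
    unfold soloLog
    ring
  rw [e, Real.exp_sub, Real.exp_log hb, Real.exp_log (by positivity)]

theorem InGaps.pos (hC : GapBounds lam C) {P : ℕ → ℝ} (hP : InGaps lam P) {i : ℕ} (hi : 1 ≤ i) :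
    0 < P i :=
  (hC.lam_pos _).trans_le (hP i hi).1

theorem kZero_eq (hC : GapBounds lam C) (g : ℕ) :
    kZero lam g = √(lam 0) * ∏ l ∈ Finset.Icc 1 g, √(lam (2 * l - 1) * lam (2 * l)) := by
  unfold kZero
  rw [prod_range_split, Real.sqrt_mul hC.pos.le, Real.sqrt_prod]
  exact fun l _ => (mul_pos (hC.lam_pos _) (hC.lam_pos _)).le

theorem sub_zero_pos (hC : GapBounds lam C) {P : ℕ → ℝ} (hP : InGaps lam P) {i : ℕ} (hi : 1 ≤ i) :
    lam 1 - lam 0 ≤ P i - lam 0 ∧ 0 < lam 1 - lam 0 := by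
  have h1 : lam 1 ≤ lam (2 * i - 1) := hC.strictMono.monotone (by omega)
  have h2 : lam 0 < lam 1 := hC.strictMono (by norm_num)
  constructor <;> linarith [(hP i hi).1]

theorem speed_eq (hC : GapBounds lam C) {g i : ℕ} (hi : i ∈ Finset.Icc 1 g) {P : ℕ → ℝ}
    (hP : InGaps lam P) : speed lam g i P = speedSign g i * Real.exp (logSpeed lam g i P) := by
  have hi1 := (Finset.mem_Icc.1 hi).1
  have h0 := sub_zero_pos hC hP hi1
  have h0' : 0 < P i - lam 0 := h0.2.trans_le h0.1
  have hl0 := hC.pos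
  have e0 : Real.exp ((Real.log (P i - lam 0) - Real.log (lam 0)) / 2)
      = √(P i - lam 0) / √(lam 0) := by
    rw [sub_div, Real.exp_sub, ← Real.log_sqrt h0'.le, ← Real.log_sqrt hl0.le,
      Real.exp_log (Real.sqrt_pos.2 h0'), Real.exp_log (Real.sqrt_pos.2 hl0)]
  have e1 : Real.exp (∑ l ∈ Finset.Icc 1 g, soloLog lam l (P l))
      = (∏ l ∈ Finset.Icc 1 g, P l) / ∏ l ∈ Finset.Icc 1 g, √(lam (2 * l - 1) * lam (2 * l)) := by
    rw [Real.exp_sum, ← Finset.prod_div_distrib]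
    exact Finset.prod_congr rfl fun l hl =>
      exp_soloLog hC l (hP.pos hC (Finset.mem_Icc.1 hl).1)
  have e2 : Real.exp (∑ j ∈ (Finset.Icc 1 g).erase i, pairLog lam j (P i) (P j))
      = (∏ j ∈ (Finset.Icc 1 g).erase i, √((P i - lam (2 * j - 1)) * (P i - lam (2 * j)))) /
        ∏ j ∈ (Finset.Icc 1 g).erase i, |P i - P j| := by
    rw [Real.exp_sum, ← Finset.prod_div_distrib]
    refine Finset.prod_congr rfl fun j hj => ?_
    simp only [Finset.mem_erase, Finset.mem_Icc] at hj
    exact exp_pairLog hC.strictMono (Ne.symm hj.1) (hP i hi1) (hP j hj.2.1)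
  have e3 : ∏ j ∈ (Finset.Icc 1 g).erase i, (P j - P i)
      = speedSign g i * ∏ j ∈ (Finset.Icc 1 g).erase i, |P i - P j| := by
    unfold speedSign
    rw [← Finset.prod_mul_distrib]
    refine Finset.prod_congr rfl fun j hj => ?_
    simp only [Finset.mem_erase, Finset.mem_Icc] at hj
    have hPi := hP i hi1
    have hPj := hP j hj.2.1
    split_ifs with hlt
    · have : lam (2 * j) ≤ lam (2 * i - 1) := hC.strictMono.monotone (by omega)
      rw [abs_of_nonneg (by linarith)]
      ring
    · have : lam (2 * i) ≤ lam (2 * j - 1) := hC.strictMono.monotone (by omega)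
      rw [abs_of_nonpos (by linarith)]
      ring
  have hs : speedSign g i = (speedSign g i)⁻¹ := by
    have := abs_speedSign g i
    rcases (abs_eq zero_le_one).1 this with h | h <;> rw [h] <;> norm_num
  unfold speed logSpeed
  rw [Real.exp_add, Real.exp_add, e0, e1, e2, e3, kZero_eq hC]
  nth_rewrite 2 [hs]
  simp only [div_eq_mul_inv, mul_inv]
  ring

/-! ### Bounds and Lipschitz estimates for the logarithm of the speed -/

theorem abs_log_sub_log_le {h x y : ℝ} (hh : 0 < h) (hx : h ≤ |x|) (hy : h ≤ |y|) :
    |Real.log x - Real.log y| ≤ |x - y| / h := by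
  have key : ∀ u v : ℝ, h ≤ |u| → h ≤ |v| → Real.log u - Real.log v ≤ |u - v| / h := by
    intro u v hu hv
    have hu' : 0 < |u| := hh.trans_le hu
    have hv' : 0 < |v| := hh.trans_le hv
    rw [← Real.log_abs u, ← Real.log_abs v, ← Real.log_div hu'.ne' hv'.ne']
    have h1 := Real.log_le_sub_one_of_pos (div_pos hu' hv')
    have h2 : |u| / |v| - 1 = (|u| - |v|) / |v| := by field_simp
    have h3 : (|u| - |v|) / |v| ≤ |u - v| / |v| :=
      div_le_div_of_nonneg_right (abs_sub_abs_le_abs_sub u v) hv'.le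
    have h4 : |u - v| / |v| ≤ |u - v| / h := div_le_div_of_nonneg_left (abs_nonneg _) hh hv
    linarith
  rw [abs_le]
  have h1 := key x y hx hy
  have h2 := key y x hy hx
  rw [abs_sub_comm] at h2
  constructor <;> linarith

/-- A second difference of the logarithm is of second order: the two increments `a - a'` and
`b - c` both occur as factors. -/
theorem abs_log_cross_le {h a a' b c : ℝ} (hh : 0 < h) (h1 : h ≤ |a - b|) (h2 : h ≤ |a - c|)
    (h3 : h ≤ |a' - b|) (h4 : h ≤ |a' - c|) :
    |(Real.log (a - c) - Real.log (a - b)) - (Real.log (a' - c) - Real.log (a' - b))|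
      ≤ |a - a'| * |b - c| / h ^ 2 := by
  have n1 : a - b ≠ 0 := abs_pos.1 (hh.trans_le h1)
  have n2 : a - c ≠ 0 := abs_pos.1 (hh.trans_le h2)
  have n3 : a' - b ≠ 0 := abs_pos.1 (hh.trans_le h3)
  have n4 : a' - c ≠ 0 := abs_pos.1 (hh.trans_le h4)
  have e : (Real.log (a - c) - Real.log (a - b)) - (Real.log (a' - c) - Real.log (a' - b))
      = Real.log ((a - c) * (a' - b)) - Real.log ((a - b) * (a' - c)) := by
    rw [Real.log_mul n2 n3, Real.log_mul n1 n4]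
    ring
  rw [e]
  have hx : h ^ 2 ≤ |(a - c) * (a' - b)| := by
    rw [abs_mul, sq]
    exact mul_le_mul h2 h3 hh.le (abs_nonneg _)
  have hy : h ^ 2 ≤ |(a - b) * (a' - c)| := by
    rw [abs_mul, sq]
    exact mul_le_mul h1 h4 hh.le (abs_nonneg _)
  refine (abs_log_sub_log_le (by positivity) hx hy).trans (le_of_eq ?_)
  rw [← abs_mul, ← abs_neg]
  congr 2
  ring

theorem abs_pairLog_le (h : StrictMono lam) {i j : ℕ} (hij : i ≠ j) {a b : ℝ}
    (ha : lam (2 * i - 1) ≤ a ∧ a ≤ lam (2 * i)) (hb : lam (2 * j - 1) ≤ b ∧ b ≤ lam (2 * j)) :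
    |pairLog lam j a b| ≤ gapLen lam j / gapDist lam i j := by
  have hp := gapDist_pos h hij
  have key : ∀ c, lam (2 * j - 1) ≤ c ∧ c ≤ lam (2 * j) →
      |Real.log (a - c) - Real.log (a - b)| ≤ gapLen lam j / gapDist lam i j := by
    intro c hc
    refine (abs_log_sub_log_le hp (gapDist_le_abs_sub ha hc) (gapDist_le_abs_sub ha hb)).trans ?_
    refine div_le_div_of_nonneg_right ?_ hp.le
    rw [sub_sub_sub_cancel_left]
    exact abs_sub_le_gapLen hb hc
  have h1 := abs_le.1 (key _ (left_mem_gap h j))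
  have h2 := abs_le.1 (key _ (right_mem_gap h j))
  unfold pairLog
  rw [abs_le]
  constructor <;> linarith

theorem abs_pairLog_sub_le (h : StrictMono lam) {i j : ℕ} (hij : i ≠ j) {a a' b b' : ℝ}
    (ha : lam (2 * i - 1) ≤ a ∧ a ≤ lam (2 * i)) (hb : lam (2 * j - 1) ≤ b ∧ b ≤ lam (2 * j))
    (ha' : lam (2 * i - 1) ≤ a' ∧ a' ≤ lam (2 * i))
    (hb' : lam (2 * j - 1) ≤ b' ∧ b' ≤ lam (2 * j)) :
    |pairLog lam j a b - pairLog lam j a' b'| ≤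
      |b - b'| / gapDist lam i j + |a - a'| * (gapLen lam j / gapDist lam i j ^ 2) := by
  have hp := gapDist_pos h hij
  have key : ∀ c, lam (2 * j - 1) ≤ c ∧ c ≤ lam (2 * j) →
      |(Real.log (a - c) - Real.log (a - b')) - (Real.log (a' - c) - Real.log (a' - b'))|
        ≤ |a - a'| * (gapLen lam j / gapDist lam i j ^ 2) := by
    intro c hc
    refine (abs_log_cross_le hp (gapDist_le_abs_sub ha hb') (gapDist_le_abs_sub ha hc)
      (gapDist_le_abs_sub ha' hb') (gapDist_le_abs_sub ha' hc)).trans ?_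
    rw [mul_div_assoc]
    exact mul_le_mul_of_nonneg_left
      (div_le_div_of_nonneg_right (abs_sub_le_gapLen hb' hc) (by positivity)) (abs_nonneg _)
  have h1 := abs_le.1 (key _ (left_mem_gap h j))
  have h2 := abs_le.1 (key _ (right_mem_gap h j))
  have h3 := abs_log_sub_log_le hp (gapDist_le_abs_sub ha hb') (gapDist_le_abs_sub ha hb)
  rw [sub_sub_sub_cancel_left] at h3
  have h3 := abs_le.1 h3
  unfold pairLog
  rw [abs_le]
  constructor <;> linarith

theorem abs_soloLog_le (hC : GapBounds lam C) {l : ℕ} {b : ℝ}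
    (hb : lam (2 * l - 1) ≤ b ∧ b ≤ lam (2 * l)) : |soloLog lam l b| ≤ C * gapLen lam l := by
  have key : ∀ c, lam (2 * l - 1) ≤ c ∧ c ≤ lam (2 * l) →
      |Real.log b - Real.log c| ≤ C * gapLen lam l := by
    intro c hc
    have hm : lam 0 ≤ lam (2 * l - 1) := hC.strictMono.monotone (Nat.zero_le _)
    have h1 := abs_log_sub_log_le (x := b) (y := c) hC.pos
      ((hm.trans hb.1).trans (le_abs_self _)) ((hm.trans hc.1).trans (le_abs_self _))
    refine h1.trans ?_
    rw [div_eq_mul_one_div, mul_comm]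
    exact mul_le_mul hC.inv_zero (abs_sub_le_gapLen hb hc) (abs_nonneg _) hC.nonneg
  have h1 := abs_le.1 (key _ (left_mem_gap hC.strictMono l))
  have h2 := abs_le.1 (key _ (right_mem_gap hC.strictMono l))
  unfold soloLog
  rw [abs_le]
  constructor <;> linarith

theorem abs_soloLog_sub_le (hC : GapBounds lam C) {l : ℕ} {b b' : ℝ}
    (hb : lam (2 * l - 1) ≤ b ∧ b ≤ lam (2 * l)) (hb' : lam (2 * l - 1) ≤ b' ∧ b' ≤ lam (2 * l)) :
    |soloLog lam l b - soloLog lam l b'| ≤ C * |b - b'| := by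
  have hm : lam 0 ≤ lam (2 * l - 1) := hC.strictMono.monotone (Nat.zero_le _)
  have h1 := abs_log_sub_log_le (x := b) (y := b') hC.pos
    ((hm.trans hb.1).trans (le_abs_self _)) ((hm.trans hb'.1).trans (le_abs_self _))
  have e : soloLog lam l b - soloLog lam l b' = Real.log b - Real.log b' := by
    unfold soloLog
    ring
  rw [e]
  refine h1.trans ?_
  rw [div_eq_mul_one_div, mul_comm]
  exact mul_le_mul_of_nonneg_right hC.inv_zero (abs_nonneg _)

/-- An upper bound for the speeds which depends on neither the number of gaps nor the positions. -/
theorem exists_logSpeed_le (hC : GapBounds lam C) {lamStar : ℝ} (hle : ∀ n, lam n ≤ lamStar) :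
    ∃ A, ∀ (g i : ℕ) (P : ℕ → ℝ), i ∈ Finset.Icc 1 g → InGaps lam P → logSpeed lam g i P ≤ A := by
  refine ⟨(Real.log (lamStar - lam 0) - Real.log (lam 0)) / 2 + C * (C * C) + C * C, ?_⟩
  intro g i P hi hP
  have hi1 := (Finset.mem_Icc.1 hi).1
  have h0 := sub_zero_pos hC hP hi1
  have h1 : Real.log (P i - lam 0) ≤ Real.log (lamStar - lam 0) :=
    Real.log_le_log (h0.2.trans_le h0.1) (sub_le_sub_right ((hP i hi1).2.trans (hle _)) _)
  have h2 : ∑ l ∈ Finset.Icc 1 g, soloLog lam l (P l) ≤ C * (C * C) := by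
    refine le_trans (Finset.sum_le_sum fun l hl => (le_abs_self _).trans
      (abs_soloLog_le hC (hP l (Finset.mem_Icc.1 hl).1))) ?_
    rw [← Finset.mul_sum]
    exact mul_le_mul_of_nonneg_left (hC.sum_gapLen_le fun k hk => (Finset.mem_Icc.1 hk).1) hC.nonneg
  have hs : ∀ k ∈ (Finset.Icc 1 g).erase i, 1 ≤ k ∧ k ≠ i := fun k hk => by
    simp only [Finset.mem_erase, Finset.mem_Icc] at hk
    exact ⟨hk.2.1, hk.1⟩
  have h3 : ∑ j ∈ (Finset.Icc 1 g).erase i, pairLog lam j (P i) (P j) ≤ C * C := by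
    refine le_trans (Finset.sum_le_sum fun j hj => (le_abs_self _).trans
      (abs_pairLog_le hC.strictMono (hs j hj).2.symm (hP i hi1) (hP j (hs j hj).1))) ?_
    exact hC.sum_gapLen_div_le i hs
  unfold logSpeed
  linarith

/-- The Lipschitz estimate for the speeds, in the sup norm of the displacements divided by
`√d_j`. -/
theorem abs_logSpeed_sub_le (hC : GapBounds lam C) {g i : ℕ} (hi : i ∈ Finset.Icc 1 g)
    {P Q : ℕ → ℝ} (hP : InGaps lam P) (hQ : InGaps lam Q) {D : ℝ}
    (hD : ∀ j ∈ Finset.Icc 1 g, |P j - Q j| ≤ √(gapLen lam j) * D) :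
    |logSpeed lam g i P - logSpeed lam g i Q| ≤ (2 * (C * C) + C + C * C * C) * D := by
  have hi1 := (Finset.mem_Icc.1 hi).1
  have hD0 : 0 ≤ D :=
    nonneg_of_mul_nonneg_right ((abs_nonneg _).trans (hD i hi))
      (Real.sqrt_pos.2 (gapLen_pos hC.strictMono hi1))
  have hdi : |P i - Q i| ≤ C * D :=
    (hD i hi).trans (mul_le_mul_of_nonneg_right (hC.sqrt_le hi1) hD0)
  have hs : ∀ k ∈ (Finset.Icc 1 g).erase i, 1 ≤ k ∧ k ≠ i := fun k hk => by
    simp only [Finset.mem_erase, Finset.mem_Icc] at hk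
    exact ⟨hk.2.1, hk.1⟩
  have h0 : |Real.log (P i - lam 0) - Real.log (Q i - lam 0)| ≤ C * (C * D) := by
    have a := sub_zero_pos hC hP hi1
    have b := sub_zero_pos hC hQ hi1
    refine (abs_log_sub_log_le a.2 (a.1.trans (le_abs_self _)) (b.1.trans (le_abs_self _))).trans ?_
    rw [sub_sub_sub_cancel_right, div_eq_mul_one_div, mul_comm]
    exact mul_le_mul hC.inv_sub hdi (abs_nonneg _) hC.nonneg
  have h1 : |∑ l ∈ Finset.Icc 1 g, (soloLog lam l (P l) - soloLog lam l (Q l))| ≤ C * C * D := by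
    refine (Finset.abs_sum_le_sum_abs _ _).trans ?_
    calc ∑ l ∈ Finset.Icc 1 g, |soloLog lam l (P l) - soloLog lam l (Q l)|
        ≤ ∑ l ∈ Finset.Icc 1 g, C * (√(gapLen lam l) * D) := by
          refine Finset.sum_le_sum fun l hl => ?_
          have hl1 := (Finset.mem_Icc.1 hl).1
          exact (abs_soloLog_sub_le hC (hP l hl1) (hQ l hl1)).trans
            (mul_le_mul_of_nonneg_left (hD l hl) hC.nonneg)
      _ = C * (∑ l ∈ Finset.Icc 1 g, √(gapLen lam l)) * D := by
          rw [mul_assoc, Finset.sum_mul, Finset.mul_sum]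
      _ ≤ C * C * D := mul_le_mul_of_nonneg_right (mul_le_mul_of_nonneg_left
          (hC.sum_sqrt _ fun k hk => (Finset.mem_Icc.1 hk).1) hC.nonneg) hD0
  have h2 : |∑ j ∈ (Finset.Icc 1 g).erase i,
      (pairLog lam j (P i) (P j) - pairLog lam j (Q i) (Q j))| ≤ C * D + C * C * C * D := by
    refine (Finset.abs_sum_le_sum_abs _ _).trans ?_
    calc ∑ j ∈ (Finset.Icc 1 g).erase i, |pairLog lam j (P i) (P j) - pairLog lam j (Q i) (Q j)|
        ≤ ∑ j ∈ (Finset.Icc 1 g).erase i, (√(gapLen lam j) / gapDist lam i j * D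
            + √(gapLen lam i) * D * (gapLen lam j / gapDist lam i j ^ 2)) := by
          refine Finset.sum_le_sum fun j hj => ?_
          have hj' := hs j hj
          refine (abs_pairLog_sub_le hC.strictMono hj'.2.symm (hP i hi1) (hP j hj'.1) (hQ i hi1)
            (hQ j hj'.1)).trans (add_le_add ?_ ?_)
          · rw [div_mul_eq_mul_div]
            exact div_le_div_of_nonneg_right (hD j (Finset.mem_of_mem_erase hj))
              (gapDist_pos hC.strictMono hj'.2.symm).le
          · exact mul_le_mul_of_nonneg_right (hD i hi)
              (div_nonneg (gapLen_nonneg hC.strictMono j) (sq_nonneg _))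
      _ = (∑ j ∈ (Finset.Icc 1 g).erase i, √(gapLen lam j) / gapDist lam i j) * D
          + √(gapLen lam i) * (∑ j ∈ (Finset.Icc 1 g).erase i,
            gapLen lam j / gapDist lam i j ^ 2) * D := by
          rw [Finset.sum_add_distrib, ← Finset.sum_mul, ← Finset.mul_sum]
          ring
      _ ≤ C * D + C * C * C * D :=
          add_le_add (mul_le_mul_of_nonneg_right (hC.sum_div i _ hs) hD0)
            (mul_le_mul_of_nonneg_right (hC.sqrt_mul_sum_gapLen_div_sq_le hi1 hs) hD0)
  rw [Finset.sum_sub_distrib] at h1 h2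
  have h0 := abs_le.1 h0
  have h1 := abs_le.1 h1
  have h2 := abs_le.1 h2
  have hCD : 0 ≤ C * (C * D) := mul_nonneg hC.nonneg (mul_nonneg hC.nonneg hD0)
  unfold logSpeed
  rw [abs_le]
  constructor <;> nlinarith

/-- Removing the gaps beyond the `g`-th one changes the speeds by little, in the weighted norm. -/
theorem sqrt_mul_abs_logSpeed_sub_le (hC : GapBounds lam C) {g g' i : ℕ} (hi : i ∈ Finset.Icc 1 g)
    (hg : g ≤ g') {P : ℕ → ℝ} (hP : InGaps lam P) :
    √(gapLen lam i) * |logSpeed lam g' i P - logSpeed lam g i P|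
      ≤ (C * C + C) * ∑ k ∈ Finset.Icc (g + 1) g', gapLen lam k := by
  have hi' := Finset.mem_Icc.1 hi
  have hdisj : Disjoint (Finset.Icc 1 g) (Finset.Icc (g + 1) g') := by
    rw [Finset.disjoint_left]
    intro k hk hk'
    simp only [Finset.mem_Icc] at hk hk'
    omega
  have hun : Finset.Icc 1 g' = Finset.Icc 1 g ∪ Finset.Icc (g + 1) g' := by
    ext k
    simp only [Finset.mem_Icc, Finset.mem_union]
    omega
  have hni : i ∉ Finset.Icc (g + 1) g' := by
    simp only [Finset.mem_Icc]
    omega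
  have hue : (Finset.Icc 1 g').erase i = (Finset.Icc 1 g).erase i ∪ Finset.Icc (g + 1) g' := by
    rw [hun, Finset.erase_union_distrib, Finset.erase_eq_of_notMem hni]
  have e : logSpeed lam g' i P - logSpeed lam g i P =
      ∑ l ∈ Finset.Icc (g + 1) g', soloLog lam l (P l) +
      ∑ j ∈ Finset.Icc (g + 1) g', pairLog lam j (P i) (P j) := by
    unfold logSpeed
    rw [hue, hun, Finset.sum_union hdisj,
      Finset.sum_union (Finset.disjoint_of_subset_left (Finset.erase_subset _ _) hdisj)]
    ring
  have hs : ∀ k ∈ Finset.Icc (g + 1) g', 1 ≤ k ∧ k ≠ i := fun k hk => by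
    simp only [Finset.mem_Icc] at hk
    omega
  have h1 : |∑ l ∈ Finset.Icc (g + 1) g', soloLog lam l (P l)|
      ≤ C * ∑ k ∈ Finset.Icc (g + 1) g', gapLen lam k := by
    rw [Finset.mul_sum]
    exact (Finset.abs_sum_le_sum_abs _ _).trans (Finset.sum_le_sum fun l hl =>
      abs_soloLog_le hC (hP l (hs l hl).1))
  have h2 : |∑ j ∈ Finset.Icc (g + 1) g', pairLog lam j (P i) (P j)|
      ≤ ∑ k ∈ Finset.Icc (g + 1) g', gapLen lam k / gapDist lam i k :=
    (Finset.abs_sum_le_sum_abs _ _).trans (Finset.sum_le_sum fun j hj =>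
      abs_pairLog_le hC.strictMono (hs j hj).2.symm (hP i hi'.1) (hP j (hs j hj).1))
  have h3 := hC.sqrt_mul_sum_gapLen_div_le hi'.1 hs
  have hw := Real.sqrt_nonneg (gapLen lam i)
  have hτ : 0 ≤ C * ∑ k ∈ Finset.Icc (g + 1) g', gapLen lam k :=
    mul_nonneg hC.nonneg (Finset.sum_nonneg fun k _ => gapLen_nonneg hC.strictMono k)
  rw [e]
  calc _ ≤ √(gapLen lam i) * (C * ∑ k ∈ Finset.Icc (g + 1) g', gapLen lam k)
        + √(gapLen lam i) * ∑ k ∈ Finset.Icc (g + 1) g', gapLen lam k / gapDist lam i k := by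
        rw [← mul_add]
        exact mul_le_mul_of_nonneg_left ((abs_add_le _ _).trans (add_le_add h1 h2)) hw
    _ ≤ C * (C * ∑ k ∈ Finset.Icc (g + 1) g', gapLen lam k)
        + C * ∑ k ∈ Finset.Icc (g + 1) g', gapLen lam k :=
        add_le_add (mul_le_mul_of_nonneg_right (hC.sqrt_le hi'.1) hτ) h3
    _ = _ := by ring

end

/-! ### Comparison of pole motions with different numbers of poles -/

theorem norm_le_mul_exp_of_norm_deriv_le {F : Type*} [NormedAddCommGroup F] [NormedSpace ℝ F]
    {f f' : ℝ → F} {K τ : ℝ} (hK : 0 < K) (hτ : 0 ≤ τ) (hf : ∀ x, HasDerivAt f (f' x) x)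
    (h0 : f 0 = 0) (hb : ∀ x, ‖f' x‖ ≤ K * ‖f x‖ + K * τ) (x : ℝ) :
    ‖f x‖ ≤ τ * Real.exp (K * |x|) := by
  have key : ∀ (u u' : ℝ → F), (∀ x, HasDerivAt u (u' x) x) → u 0 = 0 →
      (∀ x, ‖u' x‖ ≤ K * ‖u x‖ + K * τ) → ∀ y, 0 ≤ y → ‖u y‖ ≤ τ * Real.exp (K * y) := by
    intro u u' hu hu0 hub y hy
    have h1 := norm_le_gronwallBound_of_norm_deriv_right_le (f := u) (f' := u') (δ := 0) (K := K)
      (ε := K * τ) (a := 0) (b := y) (fun z _ => (hu z).continuousAt.continuousWithinAt)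
      (fun z _ => (hu z).hasDerivWithinAt) (by simp [hu0]) (fun z _ => hub z) y ⟨hy, le_rfl⟩
    rw [gronwallBound_of_K_ne_0 hK.ne', mul_div_cancel_left₀ _ hK.ne'] at h1
    simp only [sub_zero, zero_mul, zero_add] at h1
    linarith
  rcases le_total 0 x with hx | hx
  · rw [abs_of_nonneg hx]
    exact key f f' hf h0 hb x hx
  · rw [abs_of_nonpos hx]
    -- Negative `x` are reduced to positive ones by reflection.
    have hu : ∀ y, HasDerivAt (fun y => f (-y)) (-f' (-y)) y := fun y => by
      have h := (hf (-y)).scomp y (hasDerivAt_neg y)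
      rwa [neg_smul, one_smul] at h
    simpa using key (fun y => f (-y)) (fun y => -f' (-y)) hu (by simpa using h0)
      (fun y => by simpa using hb (-y)) (-x) (by linarith)

theorem abs_exp_sub_exp_le {A x y : ℝ} (hx : x ≤ A) (hy : y ≤ A) :
    |Real.exp x - Real.exp y| ≤ Real.exp A * |x - y| := by
  have key : ∀ u v : ℝ, u ≤ A → Real.exp u - Real.exp v ≤ Real.exp A * |u - v| := by
    intro u v hu
    have h1 := Real.add_one_le_exp (v - u)
    have h2 : Real.exp v = Real.exp u * Real.exp (v - u) := by rw [← Real.exp_add]; ring_nf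
    have h3 : Real.exp u * (u - v) ≤ Real.exp u * |u - v| :=
      mul_le_mul_of_nonneg_left (le_abs_self _) (Real.exp_pos u).le
    have h4 : Real.exp u * |u - v| ≤ Real.exp A * |u - v| :=
      mul_le_mul_of_nonneg_right (Real.exp_le_exp.2 hu) (abs_nonneg _)
    nlinarith [Real.exp_pos u]
  have h1 := key x y hx
  have h2 := key y x hy
  rw [abs_sub_comm] at h2
  rw [abs_le]
  constructor <;> linarith

section

variable {lam : ℕ → ℝ} {C δ Δ : ℝ}

theorem IsPoleMotion.hasDerivAt_angle {g : ℕ} {p M : ℝ → ℝ} {θ₀ : ℕ → ℝ} {θ : ℕ → ℝ → ℝ}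
    (hθ : IsPoleMotion lam g p M θ₀ θ) {i : ℕ} (hi : i ∈ Finset.Icc 1 g) (x : ℝ) :
    HasDerivAt (θ i) (M x / p x * speed lam g i (fun j => pole lam j (θ j x))) x := by
  refine (hθ.ode i hi x).congr_deriv ?_
  unfold speed kReg
  rw [div_mul_div_comm]
  congr 1 <;> ring

theorem MemE2.abs_div_le {p M : ℝ → ℝ} (hδ : 0 < δ) (h : MemE2 δ Δ p M) (x : ℝ) :
    |M x / p x| ≤ Δ / δ := by
  have h1 := h.p_lower x
  have h2 := h.M_lower x
  have h3 := h.M_upper x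
  rw [abs_of_nonneg (div_nonneg (by linarith) (by linarith))]
  exact div_le_div₀ (by linarith) h3 hδ h1

/-- The velocity of the projected pole carries a factor `d_i`, the Lipschitz constant of the
projection to the gap. -/
theorem exists_abs_deriv_pole_le (hC : GapBounds lam C) {lamStar : ℝ}
    (hle : ∀ n, lam n ≤ lamStar) (hδ : 0 < δ) (hδΔ : δ ≤ Δ) :
    ∃ V, 0 ≤ V ∧ ∀ (p M : ℝ → ℝ), MemE2 δ Δ p M → ∀ (g : ℕ) (θ₀ : ℕ → ℝ) (θ : ℕ → ℝ → ℝ),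
      IsPoleMotion lam g p M θ₀ θ → ∀ i ∈ Finset.Icc 1 g, ∀ x,
        ∃ v, HasDerivAt (fun s => pole lam i (θ i s)) v x ∧ |v| ≤ V * gapLen lam i := by
  obtain ⟨A, hA⟩ := exists_logSpeed_le hC hle
  have hR : 0 ≤ Δ / δ := div_nonneg (hδ.le.trans hδΔ) hδ.le
  refine ⟨Δ / δ * Real.exp A, by positivity, ?_⟩
  intro p M hE g θ₀ θ hθ i hi x
  have hd : DifferentiableAt ℝ (pole lam i) (θ i x) := by
    unfold pole
    fun_prop
  refine ⟨_, hd.hasDerivAt.comp x (hθ.hasDerivAt_angle hi x), ?_⟩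
  have hP : InGaps lam (fun j => pole lam j (θ j x)) := inGaps_pole hC.strictMono _
  have h1 : |deriv (pole lam i) (θ i x)| ≤ gapLen lam i := by
    have hl : LipschitzWith (gapLen lam i).toNNReal (pole lam i) :=
      LipschitzWith.of_dist_le_mul fun a b => by
        rw [Real.coe_toNNReal _ (gapLen_nonneg hC.strictMono i), Real.dist_eq, Real.dist_eq]
        exact abs_pole_sub_pole_le hC.strictMono i a b
    have := norm_deriv_le_of_lipschitz (x₀ := θ i x) hl
    rwa [Real.coe_toNNReal _ (gapLen_nonneg hC.strictMono i)] at this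
  have h2 : |speed lam g i (fun j => pole lam j (θ j x))| ≤ Real.exp A := by
    rw [speed_eq hC hi hP, abs_mul, abs_speedSign, one_mul, Real.abs_exp]
    exact Real.exp_le_exp.2 (hA g i _ hi hP)
  rw [abs_mul, abs_mul, mul_comm]
  exact mul_le_mul (mul_le_mul (hE.abs_div_le hδ x) h2 (abs_nonneg _) hR) h1 (abs_nonneg _)
    (by positivity)

/-- Grönwall's inequality for the angles with the weights `√d_i`: the motions of the first `g` and
of the first `g'` poles from the same initial points differ by the total length of the gaps in
between. -/
theorem exists_abs_pole_sub_le (hC : GapBounds lam C) {lamStar : ℝ}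
    (hle : ∀ n, lam n ≤ lamStar) (hδ : 0 < δ) (hδΔ : δ ≤ Δ) :
    ∃ K, ∀ (p M : ℝ → ℝ), MemE2 δ Δ p M → ∀ (g g' : ℕ) (θ₀ : ℕ → ℝ) (θ θ' : ℕ → ℝ → ℝ), g ≤ g' →
      IsPoleMotion lam g p M θ₀ θ → IsPoleMotion lam g' p M θ₀ θ' → ∀ i ∈ Finset.Icc 1 g, ∀ x,
        |pole lam i (θ i x) - pole lam i (θ' i x)| ≤
          √(gapLen lam i) *
            ((∑ k ∈ Finset.Icc (g + 1) g', gapLen lam k) * Real.exp (K * |x|)) := by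
  obtain ⟨A, hA⟩ := exists_logSpeed_le hC hle
  set R : ℝ := Δ / δ with hRdef
  have hR : 0 ≤ R := div_nonneg (hδ.le.trans hδΔ) hδ.le
  have hC0 := hC.nonneg
  set L : ℝ := 2 * (C * C) + C + C * C * C with hLdef
  have hL : 0 ≤ L := by positivity
  -- One constant serves for both terms of the differential inequality, and `+ 1` makes it positive.
  set K : ℝ := R * Real.exp A * (C * L + (C * C + C)) + 1 with hKdef
  have hK : 0 < K := by positivity
  refine ⟨K, ?_⟩
  intro p M hE g g' θ₀ θ θ' hgg hθ hθ'
  have hsub : Finset.Icc 1 g ⊆ Finset.Icc 1 g' := Finset.Icc_subset_Icc le_rfl hgg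
  set τ : ℝ := ∑ k ∈ Finset.Icc (g + 1) g', gapLen lam k with hτdef
  have hτ : 0 ≤ τ := Finset.sum_nonneg fun k _ => gapLen_nonneg hC.strictMono k
  let f : ℝ → (Finset.Icc 1 g → ℝ) := fun x i => √(gapLen lam i) * (θ i x - θ' i x)
  let f' : ℝ → (Finset.Icc 1 g → ℝ) := fun x i => √(gapLen lam i) *
    (M x / p x * speed lam g i (fun j => pole lam j (θ j x)) -
      M x / p x * speed lam g' i (fun j => pole lam j (θ' j x)))
  have hf : ∀ x, HasDerivAt f (f' x) x := fun x => by
    rw [hasDerivAt_pi]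
    exact fun i => ((hθ.hasDerivAt_angle i.2 x).sub
      (hθ'.hasDerivAt_angle (hsub i.2) x)).const_mul _
  have hf0 : f 0 = 0 := by
    ext i
    simp [f, hθ.init i i.2, hθ'.init i (hsub i.2)]
  have hpole : ∀ x, ∀ j ∈ Finset.Icc 1 g,
      |pole lam j (θ j x) - pole lam j (θ' j x)| ≤ √(gapLen lam j) * ‖f x‖ := by
    intro x j hj
    have h1 : ‖f x ⟨j, hj⟩‖ ≤ ‖f x‖ := norm_le_pi_norm (f x) ⟨j, hj⟩
    simp only [f, Real.norm_eq_abs, abs_mul, abs_of_nonneg (Real.sqrt_nonneg _)] at h1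
    calc _ ≤ gapLen lam j * |θ j x - θ' j x| := abs_pole_sub_pole_le hC.strictMono _ _ _
      _ = √(gapLen lam j) * (√(gapLen lam j) * |θ j x - θ' j x|) := by
        rw [← mul_assoc, hC.sqrt_mul_sqrt]
      _ ≤ _ := mul_le_mul_of_nonneg_left h1 (Real.sqrt_nonneg _)
  have hb : ∀ x, ‖f' x‖ ≤ K * ‖f x‖ + K * τ := by
    intro x
    have hn := norm_nonneg (f x)
    refine (pi_norm_le_iff_of_nonneg (by positivity)).2 fun i => ?_
    have hi := i.2
    have hi1 := (Finset.mem_Icc.1 hi).1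
    have hP : InGaps lam (fun j => pole lam j (θ j x)) := inGaps_pole hC.strictMono _
    have hQ : InGaps lam (fun j => pole lam j (θ' j x)) := inGaps_pole hC.strictMono _
    -- The positions are changed first, with `g` poles, and then the number of poles.
    set ℓ := logSpeed lam g i (fun j => pole lam j (θ j x))
    set ℓ₁ := logSpeed lam g i (fun j => pole lam j (θ' j x))
    set ℓ' := logSpeed lam g' i (fun j => pole lam j (θ' j x))
    have e1 : |ℓ - ℓ₁| ≤ L * ‖f x‖ := abs_logSpeed_sub_le hC hi hP hQ (hpole x)
    have e2 : √(gapLen lam i) * |ℓ' - ℓ₁| ≤ (C * C + C) * τ :=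
      sqrt_mul_abs_logSpeed_sub_le hC hi hgg hQ
    have e3 : |Real.exp ℓ - Real.exp ℓ'| ≤ Real.exp A * |ℓ - ℓ'| :=
      abs_exp_sub_exp_le (hA g i _ hi hP) (hA g' i _ (hsub hi) hQ)
    have e4 : |ℓ - ℓ'| ≤ |ℓ - ℓ₁| + |ℓ' - ℓ₁| := by
      rw [abs_sub_comm ℓ' ℓ₁]
      exact abs_sub_le _ _ _
    have e5 : √(gapLen lam i) * |ℓ - ℓ'| ≤ C * (L * ‖f x‖) + (C * C + C) * τ := by
      calc _ ≤ √(gapLen lam i) * |ℓ - ℓ₁| + √(gapLen lam i) * |ℓ' - ℓ₁| := by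
            rw [← mul_add]
            exact mul_le_mul_of_nonneg_left e4 (Real.sqrt_nonneg _)
        _ ≤ _ := add_le_add (mul_le_mul (hC.sqrt_le hi1) e1 (abs_nonneg _) hC0) e2
    have e6 : ‖f' x i‖ = |M x / p x| * (√(gapLen lam i) * |Real.exp ℓ - Real.exp ℓ'|) := by
      simp only [f', Real.norm_eq_abs]
      rw [speed_eq hC hi hP, speed_eq hC (hsub hi) hQ, speedSign_eq hi hgg, ← mul_sub, ← mul_sub,
        abs_mul, abs_mul, abs_mul, abs_speedSign, abs_of_nonneg (Real.sqrt_nonneg _)]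
      ring
    rw [e6]
    calc |M x / p x| * (√(gapLen lam i) * |Real.exp ℓ - Real.exp ℓ'|)
        ≤ R * (√(gapLen lam i) * (Real.exp A * |ℓ - ℓ'|)) :=
          mul_le_mul (hE.abs_div_le hδ x)
            (mul_le_mul_of_nonneg_left e3 (Real.sqrt_nonneg _)) (by positivity) hR
      _ = R * Real.exp A * (√(gapLen lam i) * |ℓ - ℓ'|) := by ring
      _ ≤ R * Real.exp A * (C * (L * ‖f x‖) + (C * C + C) * τ) :=
          mul_le_mul_of_nonneg_left e5 (by positivity)
      _ ≤ K * ‖f x‖ + K * τ := by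
          have a1 : 0 ≤ R * Real.exp A * (C * C + C) * ‖f x‖ := by positivity
          have a2 : 0 ≤ R * Real.exp A * (C * L) * τ := by positivity
          rw [hKdef]
          linarith
  intro i hi x
  exact (hpole x i hi).trans (mul_le_mul_of_nonneg_left
    (norm_le_mul_exp_of_norm_deriv_le hK hτ hf hf0 hb x) (Real.sqrt_nonneg _))

end

/-! ### Products of factors close to one -/

section

variable {𝕜 : Type*} [NormedField 𝕜] {ι : Type*}

theorem norm_le_exp_of_norm_sub_one_le {x : 𝕜} {a : ℝ} (h : ‖x - 1‖ ≤ a) : ‖x‖ ≤ Real.exp a := by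
  have h1 : ‖x‖ ≤ ‖x - 1‖ + ‖(1 : 𝕜)‖ := by simpa using norm_add_le (x - 1) 1
  rw [norm_one] at h1
  linarith [Real.add_one_le_exp a]

theorem norm_prod_le_exp {s : Finset ι} {f : ι → 𝕜} {a : ι → ℝ} (h : ∀ i ∈ s, ‖f i - 1‖ ≤ a i) :
    ‖∏ i ∈ s, f i‖ ≤ Real.exp (∑ i ∈ s, a i) := by
  rw [norm_prod, Real.exp_sum]
  exact Finset.prod_le_prod (fun i _ => norm_nonneg _)
    fun i hi => norm_le_exp_of_norm_sub_one_le (h i hi)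

theorem norm_prod_sub_prod_le {s : Finset ι} {f f' : ι → 𝕜} {a : ι → ℝ}
    (h : ∀ i ∈ s, ‖f i - 1‖ ≤ a i) (h' : ∀ i ∈ s, ‖f' i - 1‖ ≤ a i) :
    ‖∏ i ∈ s, f i - ∏ i ∈ s, f' i‖ ≤ Real.exp (∑ i ∈ s, a i) * ∑ i ∈ s, ‖f i - f' i‖ := by
  classical
  induction s using Finset.induction_on with
  | empty => simp
  | insert i s his ih =>
    rw [Finset.prod_insert his, Finset.prod_insert his, Finset.sum_insert his,
      Finset.sum_insert his, Real.exp_add]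
    have ih' := ih (fun j hj => h j (Finset.mem_insert_of_mem hj))
      (fun j hj => h' j (Finset.mem_insert_of_mem hj))
    have hi := h i (Finset.mem_insert_self i s)
    have e1 := norm_le_exp_of_norm_sub_one_le hi
    have e2 := norm_prod_le_exp (s := s) fun j hj => h' j (Finset.mem_insert_of_mem hj)
    have e3 : 1 ≤ Real.exp (a i) := Real.one_le_exp ((norm_nonneg _).trans hi)
    have e4 : f i * ∏ j ∈ s, f j - f' i * ∏ j ∈ s, f' j
        = f i * (∏ j ∈ s, f j - ∏ j ∈ s, f' j) + (f i - f' i) * ∏ j ∈ s, f' j := by ring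
    rw [e4]
    have e5 : ‖f i * (∏ j ∈ s, f j - ∏ j ∈ s, f' j)‖
        ≤ Real.exp (a i) * (Real.exp (∑ i ∈ s, a i) * ∑ i ∈ s, ‖f i - f' i‖) := by
      rw [norm_mul]
      exact mul_le_mul e1 ih' (norm_nonneg _) (Real.exp_pos _).le
    have e6 : ‖(f i - f' i) * ∏ j ∈ s, f' j‖
        ≤ Real.exp (a i) * (Real.exp (∑ i ∈ s, a i) * ‖f i - f' i‖) := by
      rw [norm_mul, mul_comm]
      have e7 := mul_le_mul_of_nonneg_right e2 (norm_nonneg (f i - f' i))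
      refine e7.trans (le_mul_of_one_le_left ?_ e3)
      positivity
    refine (norm_add_le _ _).trans ((add_le_add e5 e6).trans (le_of_eq ?_))
    ring

/-- A finite product compared with an infinite one: the first `g` factors may differ, and the
remaining factors of the infinite product are close to one. -/
theorem norm_prod_sub_tprod_le {a : ℕ → ℝ} (ha : Summable a) (ha0 : ∀ k, 0 ≤ a k) {f u : ℕ → 𝕜}
    {g : ℕ} (hf : ∀ k, ‖f k - 1‖ ≤ a k) (hm : Multipliable f)
    (hu : ∀ k ∈ Finset.range g, ‖u k - 1‖ ≤ a k) :
    ‖∏ k ∈ Finset.range g, u k - ∏' k, f k‖ ≤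
      Real.exp (∑' k, a k) * (∑ k ∈ Finset.range g, ‖u k - f k‖ + ∑' k, a (k + g)) := by
  have hlim : Tendsto (fun n => ‖∏ k ∈ Finset.range g, u k - ∏ k ∈ Finset.range (n + g), f k‖)
      atTop (𝓝 ‖∏ k ∈ Finset.range g, u k - ∏' k, f k‖) :=
    (tendsto_const_nhds.sub ((tendsto_add_atTop_iff_nat g).2 hm.tendsto_prod_tprod_nat)).norm
  refine le_of_tendsto' hlim fun n => ?_
  -- The finite product is padded with ones to the length of a long partial product of `f`.
  let v : ℕ → 𝕜 := fun k => if k < g then u k else 1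
  have hv : ∏ k ∈ Finset.range (n + g), v k = ∏ k ∈ Finset.range g, u k := by
    rw [add_comm n g, Finset.prod_range_add]
    have h1 : ∏ k ∈ Finset.range g, v k = ∏ k ∈ Finset.range g, u k :=
      Finset.prod_congr rfl fun k hk => if_pos (Finset.mem_range.1 hk)
    have h2 : ∏ k ∈ Finset.range n, v (g + k) = 1 :=
      Finset.prod_eq_one fun k _ => if_neg (by omega)
    rw [h1, h2, mul_one]
  have hv1 : ∀ k ∈ Finset.range (n + g), ‖v k - 1‖ ≤ a k := by
    intro k _
    by_cases hk : k < g
    · simpa [v, hk] using hu k (Finset.mem_range.2 hk)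
    · simpa [v, hk] using ha0 k
  rw [← hv]
  refine (norm_prod_sub_prod_le hv1 fun k _ => hf k).trans ?_
  refine mul_le_mul (Real.exp_le_exp.2 (ha.sum_le_tsum _ fun k _ => ha0 k)) ?_
    (Finset.sum_nonneg fun k _ => norm_nonneg _) (Real.exp_pos _).le
  rw [add_comm n g, Finset.sum_range_add]
  refine add_le_add (Finset.sum_le_sum fun k hk => ?_) ?_
  · simp [v, Finset.mem_range.1 hk]
  · refine le_trans (Finset.sum_le_sum fun k _ => ?_)
      (((summable_nat_add_iff g).2 ha).sum_le_tsum (Finset.range n) fun k _ => ha0 _)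
    have h1 : v (g + k) = 1 := if_neg (by omega)
    rw [h1, norm_sub_rev, add_comm k g]
    exact hf _

theorem exists_hasDerivAt_prod [NormedAlgebra ℝ 𝕜] {s : Finset ι} {f : ι → ℝ → 𝕜} {v : ι → 𝕜}
    {a : ι → ℝ} {x : ℝ} (hf : ∀ i ∈ s, HasDerivAt (f i) (v i) x)
    (h : ∀ i ∈ s, ‖f i x - 1‖ ≤ a i) :
    ∃ D, HasDerivAt (fun y => ∏ i ∈ s, f i y) D x ∧
      ‖D‖ ≤ Real.exp (∑ i ∈ s, a i) * ∑ i ∈ s, ‖v i‖ := by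
  classical
  refine ⟨_, HasDerivAt.fun_finsetProd hf, ?_⟩
  rw [Finset.mul_sum]
  refine (norm_sum_le _ _).trans (Finset.sum_le_sum fun i hi => ?_)
  rw [smul_eq_mul, norm_mul]
  refine mul_le_mul_of_nonneg_right ?_ (norm_nonneg _)
  refine (norm_prod_le_exp fun j hj => h j (Finset.mem_of_mem_erase hj)).trans
    (Real.exp_le_exp.2 ?_)
  exact Finset.sum_le_sum_of_subset_of_nonneg (Finset.erase_subset _ _)
    fun j hj _ => (norm_nonneg _).trans (h j hj)

end

theorem prod_Icc_one_eq_prod_range {R : Type*} [CommMonoid R] (f : ℕ → R) (g : ℕ) :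
    ∏ i ∈ Finset.Icc 1 g, f i = ∏ k ∈ Finset.range g, f (k + 1) := by
  induction g with
  | zero => simp
  | succ n ih => rw [Finset.prod_Icc_succ_top (by omega), ih, Finset.prod_range_succ]

/-! ### The factors of the two products -/

theorem norm_E_le {n : ℕ} {w : ℂ} {q : ℝ} (hw : ‖w‖ ≤ q) :
    ‖E n w‖ ≤ Real.exp (∑ m ∈ Finset.Icc 1 n, q ^ m) := by
  unfold E
  refine (Complex.norm_exp_le_exp_norm _).trans (Real.exp_le_exp.2 ?_)
  refine (norm_sum_le _ _).trans (Finset.sum_le_sum fun m hm => ?_)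
  have hm1 : (1 : ℝ) ≤ m := by exact_mod_cast (Finset.mem_Icc.1 hm).1
  rw [norm_div, norm_pow, Complex.norm_natCast]
  exact (div_le_self (by positivity) hm1).trans (pow_le_pow_left₀ (norm_nonneg _) hw m)

theorem sum_pow_le_one {q : ℝ} (hq0 : 0 ≤ q) (hq : q ≤ 1 / 2) (n : ℕ) :
    ∑ m ∈ Finset.Icc 1 n, q ^ m ≤ 1 := by
  have key : ∑ m ∈ Finset.Icc 1 n, (1 / 2 : ℝ) ^ m = 1 - (1 / 2) ^ n := by
    induction n with
    | zero => simp
    | succ n ih =>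
      rw [Finset.sum_Icc_succ_top (by omega), ih]
      ring
  have h1 : ∑ m ∈ Finset.Icc 1 n, q ^ m ≤ ∑ m ∈ Finset.Icc 1 n, (1 / 2 : ℝ) ^ m :=
    Finset.sum_le_sum fun m _ => pow_le_pow_left₀ hq0 hq m
  have h2 : (0 : ℝ) ≤ (1 / 2) ^ n := by positivity
  linarith

/-- Weierstrass' estimate: `E_n` cancels the first `n` terms of the expansion of `log (1 - w)`. -/
theorem norm_one_sub_mul_E_sub_one_le {n : ℕ} {w : ℂ} (hw : ‖w‖ ≤ 1 / 2) :
    ‖(1 - w) * E n w - 1‖ ≤ 2 * (1 / 2) ^ n := by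
  have hw1 : ‖-w‖ < 1 := by
    rw [norm_neg]
    linarith
  have hT : Complex.logTaylor (n + 1) (-w) = -∑ m ∈ Finset.Icc 1 n, w ^ m / (m : ℂ) := by
    unfold Complex.logTaylor
    rw [Finset.sum_range_succ', ← Finset.sum_neg_distrib]
    have : ∑ m ∈ Finset.Icc 1 n, -(w ^ m / (m : ℂ))
        = ∑ k ∈ Finset.range n, -(w ^ (k + 1) / ((k + 1 : ℕ) : ℂ)) := by
      induction n with
      | zero => simp
      | succ n ih => rw [Finset.sum_Icc_succ_top (by omega), ih, Finset.sum_range_succ]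
    rw [this]
    simp only [pow_zero, CharP.cast_eq_zero, div_zero, add_zero]
    refine Finset.sum_congr rfl fun k _ => ?_
    rw [neg_pow w, ← mul_assoc, ← pow_add, show k + 1 + 1 + (k + 1) = 2 * (k + 1) + 1 by ring,
      pow_succ, pow_mul]
    norm_num
    ring
  set u := Complex.log (1 + -w) - Complex.logTaylor (n + 1) (-w) with hu
  have hu1 : ‖u‖ ≤ (1 / 2) ^ n := by
    refine (Complex.norm_log_sub_logTaylor_le n hw1).trans ?_
    rw [norm_neg]
    have h1 : ‖w‖ ^ (n + 1) ≤ (1 / 2) ^ (n + 1) := pow_le_pow_left₀ (norm_nonneg _) hw _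
    have h2 : (1 - ‖w‖)⁻¹ ≤ 2 := by
      rw [inv_le_comm₀ (by linarith) (by norm_num)]
      linarith
    have h0 : 0 ≤ (1 - ‖w‖)⁻¹ := inv_nonneg.2 (by linarith)
    have h3 : ‖w‖ ^ (n + 1) * (1 - ‖w‖)⁻¹ ≤ (1 / 2) ^ (n + 1) * 2 :=
      mul_le_mul h1 h2 h0 (by positivity)
    refine (div_le_self (by positivity) ?_).trans (h3.trans (le_of_eq (by ring)))
    have : (0 : ℝ) ≤ n := Nat.cast_nonneg n
    linarith
  have hne : 1 + -w ≠ 0 := by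
    intro h
    have : w = 1 := by linear_combination -h
    rw [this, norm_one] at hw
    norm_num at hw
  have he : (1 - w) * E n w = Complex.exp u := by
    rw [hu, hT, sub_neg_eq_add, Complex.exp_add, Complex.exp_log hne, ← sub_eq_add_neg]
    rfl
  have hu2 : ‖u‖ ≤ 1 := hu1.trans (pow_le_one₀ (by norm_num) (by norm_num))
  rw [he]
  exact (Complex.norm_exp_sub_one_le hu2).trans (mul_le_mul_of_nonneg_left hu1 (by norm_num))

section

variable {lam : ℕ → ℝ} {lamStar C : ℝ}

theorem Admissible.le_lamStar (h : Admissible lam lamStar) (n : ℕ) : lam n ≤ lamStar :=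
  h.strictMono.monotone.ge_of_tendsto h.H1 n

theorem Admissible.summable_gapLen (h : Admissible lam lamStar) : Summable (gapLen lam) :=
  (summable_nat_add_iff 1).1 h.H2

/-- Bounds for the factors of the second product outside a disc around `λ_*`: `a` bounds their
distance from `1`, and `e` their Lipschitz constants in `P`. Only for large `i` is
`(λ_* - λ_{2i}) / (λ_* - z)` in the disc of radius `1 / 2` in which Weierstrass' estimate is used;
for the other `i` any bound will do. -/
theorem exists_factor_bounds (h : Admissible lam lamStar) {r : ℝ} (hr : 0 < r) :
    ∃ (a : ℕ → ℝ) (e : ℝ), (∀ i, 0 ≤ a i) ∧ Summable a ∧ 0 ≤ e ∧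
      ∀ (i : ℕ) (z : ℂ), r ≤ ‖z - (lamStar : ℂ)‖ →
        ‖E i (((lamStar : ℂ) - (lam (2 * i) : ℂ)) / ((lamStar : ℂ) - z)) / (z - (lamStar : ℂ))‖ ≤ e ∧
        ∀ P : ℝ, lam (2 * i - 1) ≤ P ∧ P ≤ lam (2 * i) → ‖factor lam lamStar i P z - 1‖ ≤ a i := by
  let q : ℕ → ℝ := fun i => (lamStar - lam (2 * i)) / r
  let b : ℕ → ℝ := fun i => Real.exp (∑ m ∈ Finset.Icc 1 i, q i ^ m)
  have hq0 : ∀ i, 0 ≤ q i := fun i => div_nonneg (sub_nonneg.2 (h.le_lamStar _)) hr.le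
  have hq : Tendsto q atTop (𝓝 0) := by
    have h1 : Tendsto (fun i : ℕ => lam (2 * i)) atTop (𝓝 lamStar) :=
      h.H1.comp (tendsto_id.const_mul_atTop' (by norm_num))
    simpa using (h1.const_sub lamStar).div_const r
  obtain ⟨N, hN⟩ := eventually_atTop.1 (hq.eventually_le_const (show (0 : ℝ) < 1 / 2 by norm_num))
  have hb1 : ∀ i, N ≤ i → b i ≤ Real.exp 1 := fun i hi =>
    Real.exp_le_exp.2 (sum_pow_le_one (hq0 i) (hN i hi) i)
  have hb0 : ∀ i, 0 < b i := fun i => Real.exp_pos _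
  have hls : 0 < lamStar := h.pos.trans_le (h.le_lamStar 0)
  let c : ℕ → ℝ := fun i => if i < N then (1 + lamStar / r) * b i + 1 else 0
  have hc0 : ∀ i, 0 ≤ c i := fun i => by
    have := hb0 i
    simp only [c]
    split_ifs <;> positivity
  have hc : Summable c := summable_of_ne_finset_zero (s := Finset.range N) fun i hi =>
    if_neg (by simpa using hi)
  have hd := h.summable_gapLen
  have hd0 := gapLen_nonneg h.strictMono
  have hgeo : Summable fun i : ℕ => 2 * (1 / 2 : ℝ) ^ i :=
    (summable_geometric_of_lt_one (by norm_num) (by norm_num)).mul_left 2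
  refine ⟨fun i => c i + 2 * (1 / 2) ^ i + Real.exp 1 / r * gapLen lam i,
    (Real.exp 1 + ∑ i ∈ Finset.range N, b i) / r, ?_, ?_, ?_, ?_⟩
  · intro i
    have := hc0 i
    have := hd0 i
    positivity
  · exact (hc.add hgeo).add (hd.mul_left _)
  · exact div_nonneg (add_nonneg (Real.exp_pos 1).le (Finset.sum_nonneg fun i _ => (hb0 i).le)) hr.le
  intro i z hz
  have hzn : 0 < ‖z - (lamStar : ℂ)‖ := hr.trans_le hz
  have hz0 : z - (lamStar : ℂ) ≠ 0 := norm_pos_iff.1 hzn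
  have hz0' : (lamStar : ℂ) - z ≠ 0 := by
    rw [← neg_sub]
    exact neg_ne_zero.2 hz0
  set w : ℂ := ((lamStar : ℂ) - (lam (2 * i) : ℂ)) / ((lamStar : ℂ) - z) with hwdef
  have hw : ‖w‖ ≤ q i := by
    rw [hwdef, norm_div, ← Complex.ofReal_sub, Complex.norm_real, Real.norm_eq_abs,
      abs_of_nonneg (sub_nonneg.2 (h.le_lamStar _)), norm_sub_rev]
    exact div_le_div_of_nonneg_left (sub_nonneg.2 (h.le_lamStar _)) hr hz
  have hE : ‖E i w‖ ≤ b i := norm_E_le hw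
  have hdiv : ∀ y : ℝ, ‖(y : ℂ) / (z - (lamStar : ℂ))‖ ≤ |y| / r := fun y => by
    rw [norm_div, Complex.norm_real, Real.norm_eq_abs]
    exact div_le_div_of_nonneg_left (abs_nonneg _) hr hz
  constructor
  · rw [norm_div]
    have hbN : b i ≤ Real.exp 1 + ∑ i ∈ Finset.range N, b i := by
      by_cases hi : i < N
      · have := Finset.single_le_sum (fun j _ => (hb0 j).le) (Finset.mem_range.2 hi)
        linarith [Real.exp_pos 1]
      · have := Finset.sum_nonneg fun j (_ : j ∈ Finset.range N) => (hb0 j).le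
        linarith [hb1 i (not_lt.1 hi)]
    exact div_le_div₀ ((hb0 i).le.trans hbN) (hE.trans hbN) hr hz
  · intro P hP
    have hx : 0 ≤ Real.exp 1 / r * gapLen lam i :=
      mul_nonneg (div_nonneg (Real.exp_pos 1).le hr.le) (hd0 i)
    have hy : (0 : ℝ) ≤ 2 * (1 / 2) ^ i := by positivity
    by_cases hi : i < N
    · have hPs : |lamStar - P| ≤ lamStar := by
        have h1 : 0 ≤ P := (h.pos.le.trans (h.strictMono.monotone (Nat.zero_le _))).trans hP.1
        have h2 : P ≤ lamStar := hP.2.trans (h.le_lamStar _)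
        rw [abs_le]
        constructor <;> linarith
      have e1 : (z - (P : ℂ)) / (z - (lamStar : ℂ))
          = 1 + ((lamStar - P : ℝ) : ℂ) / (z - (lamStar : ℂ)) := by
        rw [Complex.ofReal_sub]
        field_simp
        ring
      have e2 : ‖(z - (P : ℂ)) / (z - (lamStar : ℂ))‖ ≤ 1 + lamStar / r := by
        rw [e1]
        refine (norm_add_le _ _).trans ?_
        rw [norm_one]
        have := (hdiv (lamStar - P)).trans (div_le_div_of_nonneg_right hPs hr.le)
        linarith
      have e3 : ‖factor lam lamStar i P z‖ ≤ (1 + lamStar / r) * b i := by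
        unfold factor
        rw [norm_mul]
        exact mul_le_mul e2 hE (norm_nonneg _) (by positivity)
      have e4 : c i = (1 + lamStar / r) * b i + 1 := if_pos hi
      have e5 := norm_sub_le (factor lam lamStar i P z) 1
      rw [norm_one] at e5
      linarith
    · have hi' := not_lt.1 hi
      have e1 : factor lam lamStar i P z - 1 = ((1 - w) * E i w - 1) +
          ((lam (2 * i) - P : ℝ) : ℂ) / (z - (lamStar : ℂ)) * E i w := by
        unfold factor
        rw [← hwdef]
        have : (z - (P : ℂ)) / (z - (lamStar : ℂ))
            = (1 - w) + ((lam (2 * i) - P : ℝ) : ℂ) / (z - (lamStar : ℂ)) := by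
          have hw' : w = -(((lamStar : ℂ) - (lam (2 * i) : ℂ)) / (z - (lamStar : ℂ))) := by
            rw [hwdef, ← div_neg, neg_sub]
          rw [hw', Complex.ofReal_sub]
          field_simp
          ring
        rw [this]
        ring
      have e2 : ‖((lam (2 * i) - P : ℝ) : ℂ) / (z - (lamStar : ℂ)) * E i w‖
          ≤ gapLen lam i / r * Real.exp 1 := by
        rw [norm_mul]
        have h1 : |lam (2 * i) - P| ≤ gapLen lam i :=
          abs_sub_le_gapLen (right_mem_gap h.strictMono i) hP
        exact mul_le_mul ((hdiv _).trans (div_le_div_of_nonneg_right h1 hr.le))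
          (hE.trans (hb1 i hi')) (norm_nonneg _) (div_nonneg (hd0 i) hr.le)
      have e3 := norm_one_sub_mul_E_sub_one_le (n := i) (hw.trans (hN i hi'))
      have e4 : gapLen lam i / r * Real.exp 1 = Real.exp 1 / r * gapLen lam i := by ring
      rw [e1]
      refine (norm_add_le _ _).trans ?_
      linarith [hc0 i]

theorem factor_eq (i : ℕ) (P : ℝ) (z : ℂ) : factor lam lamStar i P z = (z - (P : ℂ)) *
    (E i (((lamStar : ℂ) - (lam (2 * i) : ℂ)) / ((lamStar : ℂ) - z)) / (z - (lamStar : ℂ))) := by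
  unfold factor
  ring

/-- The factor `√(λ_{2i-1} λ_{2i}) / b` of the coefficient of `U_g`. -/
noncomputable def rootRatio (lam : ℕ → ℝ) (i : ℕ) (b : ℝ) : ℝ :=
  √(lam (2 * i - 1) * lam (2 * i)) / b

theorem rootRatio_eq_exp (hC : GapBounds lam C) (i : ℕ) {b : ℝ} (hb : 0 < b) :
    rootRatio lam i b = Real.exp (-soloLog lam i b) := by
  rw [Real.exp_neg, exp_soloLog hC i hb, inv_div]
  rfl

theorem abs_soloLog_le_const (hC : GapBounds lam C) {i : ℕ} (hi : 1 ≤ i) {b : ℝ}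
    (hb : lam (2 * i - 1) ≤ b ∧ b ≤ lam (2 * i)) : |soloLog lam i b| ≤ C * (C * C) :=
  (abs_soloLog_le hC hb).trans (mul_le_mul_of_nonneg_left
    ((hC.gapLen_le hi).trans (mul_le_mul_of_nonneg_left (hC.sqrt_le hi) hC.nonneg)) hC.nonneg)

theorem abs_rootRatio_sub_le (hC : GapBounds lam C) {i : ℕ} (hi : 1 ≤ i) {b b' : ℝ}
    (hb : lam (2 * i - 1) ≤ b ∧ b ≤ lam (2 * i)) (hb' : lam (2 * i - 1) ≤ b' ∧ b' ≤ lam (2 * i)) :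
    |rootRatio lam i b - rootRatio lam i b'| ≤ Real.exp (C * (C * C)) * C * |b - b'| := by
  have hp := (hC.lam_pos (2 * i - 1)).trans_le hb.1
  have hp' := (hC.lam_pos (2 * i - 1)).trans_le hb'.1
  have h1 := (abs_le.1 (abs_soloLog_le_const hC hi hb)).1
  have h2 := (abs_le.1 (abs_soloLog_le_const hC hi hb')).1
  rw [rootRatio_eq_exp hC i hp, rootRatio_eq_exp hC i hp', mul_assoc]
  refine (abs_exp_sub_exp_le (A := C * (C * C)) (by linarith) (by linarith)).trans
    (mul_le_mul_of_nonneg_left ?_ (Real.exp_pos _).le)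
  rw [neg_sub_neg, abs_sub_comm]
  exact abs_soloLog_sub_le hC hb hb'

theorem abs_rootRatio_sub_one_le (hC : GapBounds lam C) {i : ℕ} (hi : 1 ≤ i) {b : ℝ}
    (hb : lam (2 * i - 1) ≤ b ∧ b ≤ lam (2 * i)) :
    |rootRatio lam i b - 1| ≤ Real.exp (C * (C * C)) * C * gapLen lam i := by
  have hp := (hC.lam_pos (2 * i - 1)).trans_le hb.1
  have h1 := (abs_le.1 (abs_soloLog_le_const hC hi hb)).1
  have h0 : 0 ≤ C * (C * C) := mul_nonneg hC.nonneg (mul_nonneg hC.nonneg hC.nonneg)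
  rw [rootRatio_eq_exp hC i hp, ← Real.exp_zero, mul_assoc]
  refine (abs_exp_sub_exp_le (A := C * (C * C)) (by linarith) h0).trans
    (mul_le_mul_of_nonneg_left ?_ (Real.exp_pos _).le)
  rw [sub_zero, abs_neg]
  exact abs_soloLog_le hC hb

theorem Ug_eq (hC : GapBounds lam C) (g : ℕ) (p m : ℝ) (P : ℕ → ℝ) (z : ℂ) :
    Ug lam lamStar g p m P z =
      ((-2 * √(lam 0) * p / m : ℝ) : ℂ) * ((∏ i ∈ Finset.Icc 1 g, rootRatio lam i (P i) : ℝ) : ℂ) *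
        ∏ i ∈ Finset.Icc 1 g, factor lam lamStar i (P i) z := by
  unfold Ug rootRatio
  rw [← Complex.ofReal_mul, kZero_eq hC, Finset.prod_div_distrib]
  congr 2
  rw [div_mul_div_comm]
  congr 1
  ring

end

/-! ### The functions `U_g` and their limit -/

theorem norm_tprod_le_exp {𝕜 : Type*} [NormedField 𝕜] {a : ℕ → ℝ} (ha : Summable a)
    (ha0 : ∀ k, 0 ≤ a k) {f : ℕ → 𝕜} (hf : ∀ k, ‖f k - 1‖ ≤ a k) (hm : Multipliable f) :
    ‖∏' k, f k‖ ≤ Real.exp (∑' k, a k) :=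
  le_of_tendsto' hm.tendsto_prod_tprod_nat.norm fun _ =>
    (norm_prod_le_exp fun k _ => hf k).trans
      (Real.exp_le_exp.2 (ha.sum_le_tsum _ fun k _ => ha0 k))

theorem multipliable_of_norm_sub_one_le {𝕜 : Type*} [NormedField 𝕜] [CompleteSpace 𝕜] {a : ℕ → ℝ}
    (ha : Summable a) {f : ℕ → 𝕜} (hf : ∀ k, ‖f k - 1‖ ≤ a k) : Multipliable f := by
  have h := multipliable_one_add_of_summable (f := fun k => f k - 1)
    (Summable.of_nonneg_of_le (fun k => norm_nonneg _) hf ha)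
  simpa using h

section

variable {lam : ℕ → ℝ} {lamStar C δ Δ : ℝ}

theorem multipliable_rootRatio (h : Admissible lam lamStar) {P : ℕ → ℝ} (hP : InGaps lam P) :
    Multipliable fun k : ℕ => rootRatio lam (k + 1) (P (k + 1)) := by
  obtain ⟨C, hC⟩ := h.exists_gapBounds
  exact multipliable_of_norm_sub_one_le (h.H2.mul_left (Real.exp (C * (C * C)) * C))
    fun k => abs_rootRatio_sub_one_le hC (by omega) (hP (k + 1) (by omega))

theorem multipliable_factor (h : Admissible lam lamStar) {P : ℕ → ℝ} (hP : InGaps lam P) {z : ℂ}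
    (hz : z ≠ (lamStar : ℂ)) :
    Multipliable fun k : ℕ => factor lam lamStar (k + 1) (P (k + 1)) z := by
  obtain ⟨a, e, -, ha, -, hae⟩ := exists_factor_bounds h (norm_pos_iff.2 (sub_ne_zero.2 hz))
  exact multipliable_of_norm_sub_one_le ((summable_nat_add_iff 1).2 ha)
    fun k => (hae (k + 1) z le_rfl).2 _ (hP (k + 1) (by omega))

/-- The distance of `U_g` at the positions `Q` from `U` at the positions `P`. -/
theorem exists_norm_Ug_sub_Ulim_le (h : Admissible lam lamStar) {r : ℝ} (hr : 0 < r) :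
    ∃ (W : ℝ) (ε : ℕ → ℝ), 0 ≤ W ∧ (∀ g, 0 ≤ ε g) ∧ Tendsto ε atTop (𝓝 0) ∧
      ∀ (g : ℕ) (p m : ℝ) (Q P : ℕ → ℝ) (z : ℂ), InGaps lam Q → InGaps lam P →
        r ≤ ‖z - (lamStar : ℂ)‖ →
        ‖Ug lam lamStar g p m Q z - Ulim lam lamStar p m P z‖ ≤
          |p / m| * W * (∑ k ∈ Finset.range g, |Q (k + 1) - P (k + 1)| + ε g) := by
  obtain ⟨C, hC⟩ := h.exists_gapBounds
  obtain ⟨a, e, ha0, ha, he, hae⟩ := exists_factor_bounds h hr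
  have hC0 := hC.nonneg
  set e' : ℝ := Real.exp (C * (C * C)) * C with he'def
  have he' : 0 ≤ e' := by positivity
  let b : ℕ → ℝ := fun k => a (k + 1)
  let b' : ℕ → ℝ := fun k => e' * gapLen lam (k + 1)
  have hb : Summable b := (summable_nat_add_iff 1).2 ha
  have hb' : Summable b' := h.H2.mul_left e'
  have hb0 : ∀ k, 0 ≤ b k := fun k => ha0 _
  have hb0' : ∀ k, 0 ≤ b' k := fun k => mul_nonneg he' (gapLen_nonneg h.strictMono _)
  set B := Real.exp (∑' k, b k)
  set B' := Real.exp (∑' k, b' k)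
  refine ⟨2 * √(lam 0) * (B' * B * (e + e' + 1)), fun g => ∑' k, b' (k + g) + ∑' k, b (k + g),
    by positivity, fun g => add_nonneg (tsum_nonneg fun k => hb0' _) (tsum_nonneg fun k => hb0 _),
    by simpa using (tendsto_sum_nat_add b').add (tendsto_sum_nat_add b), ?_⟩
  intro g p m Q P z hQ hP hz
  have hz0 : z ≠ (lamStar : ℂ) := sub_ne_zero.1 (norm_pos_iff.1 (hr.trans_le hz))
  let u : ℕ → ℂ := fun k => factor lam lamStar (k + 1) (Q (k + 1)) z
  let f : ℕ → ℂ := fun k => factor lam lamStar (k + 1) (P (k + 1)) z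
  let u' : ℕ → ℝ := fun k => rootRatio lam (k + 1) (Q (k + 1))
  let f' : ℕ → ℝ := fun k => rootRatio lam (k + 1) (P (k + 1))
  have hu : ∀ k, ‖u k - 1‖ ≤ b k := fun k => (hae (k + 1) z hz).2 _ (hQ _ (by omega))
  have hf : ∀ k, ‖f k - 1‖ ≤ b k := fun k => (hae (k + 1) z hz).2 _ (hP _ (by omega))
  have hu' : ∀ k, ‖u' k - 1‖ ≤ b' k := fun k =>
    abs_rootRatio_sub_one_le hC (by omega) (hQ _ (by omega))
  have hf' : ∀ k, ‖f' k - 1‖ ≤ b' k := fun k =>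
    abs_rootRatio_sub_one_le hC (by omega) (hP _ (by omega))
  have hm : Multipliable f := multipliable_factor h hP hz0
  have hm' : Multipliable f' := multipliable_rootRatio h hP
  set S := ∑ k ∈ Finset.range g, |Q (k + 1) - P (k + 1)| with hS
  have hS0 : 0 ≤ S := Finset.sum_nonneg fun k _ => abs_nonneg _
  have hT0 : 0 ≤ ∑' k, b (k + g) := tsum_nonneg fun k => hb0 _
  have hT0' : 0 ≤ ∑' k, b' (k + g) := tsum_nonneg fun k => hb0' _
  have d1 : ∑ k ∈ Finset.range g, ‖u k - f k‖ ≤ e * S := by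
    rw [hS, Finset.mul_sum]
    refine Finset.sum_le_sum fun k _ => ?_
    have e1 : u k - f k = ((P (k + 1) - Q (k + 1) : ℝ) : ℂ) *
        (E (k + 1) (((lamStar : ℂ) - (lam (2 * (k + 1)) : ℂ)) / ((lamStar : ℂ) - z)) /
          (z - (lamStar : ℂ))) := by
      simp only [u, f]
      rw [factor_eq, factor_eq, Complex.ofReal_sub]
      ring
    rw [e1, norm_mul, Complex.norm_real, Real.norm_eq_abs, abs_sub_comm, mul_comm]
    exact mul_le_mul_of_nonneg_right (hae (k + 1) z hz).1 (abs_nonneg _)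
  have d2 : ∑ k ∈ Finset.range g, ‖u' k - f' k‖ ≤ e' * S := by
    rw [hS, Finset.mul_sum]
    exact Finset.sum_le_sum fun k _ =>
      abs_rootRatio_sub_le hC (by omega) (hQ _ (by omega)) (hP _ (by omega))
  have k1 : ‖∏ k ∈ Finset.range g, u k - ∏' k, f k‖ ≤ B * (e * S + ∑' k, b (k + g)) :=
    (norm_prod_sub_tprod_le hb hb0 hf hm fun k _ => hu k).trans
      (mul_le_mul_of_nonneg_left (add_le_add_left d1 _) (Real.exp_pos _).le)
  have k2 : ‖∏ k ∈ Finset.range g, u' k - ∏' k, f' k‖ ≤ B' * (e' * S + ∑' k, b' (k + g)) :=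
    (norm_prod_sub_tprod_le hb' hb0' hf' hm' fun k _ => hu' k).trans
      (mul_le_mul_of_nonneg_left (add_le_add_left d2 _) (Real.exp_pos _).le)
  have k3 : ‖∏ k ∈ Finset.range g, u k‖ ≤ B := (norm_prod_le_exp fun k _ => hu k).trans
    (Real.exp_le_exp.2 (hb.sum_le_tsum _ fun k _ => hb0 k))
  have k4 : ‖∏' k, f' k‖ ≤ B' := norm_tprod_le_exp hb' hb0' hf' hm'
  have hU : Ug lam lamStar g p m Q z = ((-2 * √(lam 0) * p / m : ℝ) : ℂ) *
      ((∏ k ∈ Finset.range g, u' k : ℝ) : ℂ) * ∏ k ∈ Finset.range g, u k := by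
    rw [Ug_eq hC, prod_Icc_one_eq_prod_range, prod_Icc_one_eq_prod_range]
  have hV : Ulim lam lamStar p m P z = ((-2 * √(lam 0) * p / m : ℝ) : ℂ) *
      ((∏' k, f' k : ℝ) : ℂ) * ∏' k, f k := by
    rw [← Complex.ofReal_mul]
    rfl
  have hc : ‖((-2 * √(lam 0) * p / m : ℝ) : ℂ)‖ = |p / m| * (2 * √(lam 0)) := by
    rw [Complex.norm_real, Real.norm_eq_abs,
      show -2 * √(lam 0) * p / m = -(p / m * (2 * √(lam 0))) by ring, abs_neg, abs_mul,
      abs_of_nonneg (by positivity : 0 ≤ 2 * √(lam 0))]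
  have hdiff : Ug lam lamStar g p m Q z - Ulim lam lamStar p m P z =
      ((-2 * √(lam 0) * p / m : ℝ) : ℂ) *
        (((∏ k ∈ Finset.range g, u' k - ∏' k, f' k : ℝ) : ℂ) * ∏ k ∈ Finset.range g, u k +
          ((∏' k, f' k : ℝ) : ℂ) * (∏ k ∈ Finset.range g, u k - ∏' k, f k)) := by
    rw [hU, hV, Complex.ofReal_sub]
    ring
  have hB : 0 < B := Real.exp_pos _
  have hB' : 0 < B' := Real.exp_pos _
  have m1 : ‖((∏ k ∈ Finset.range g, u' k - ∏' k, f' k : ℝ) : ℂ) * ∏ k ∈ Finset.range g, u k‖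
      ≤ B' * (e' * S + ∑' k, b' (k + g)) * B := by
    rw [norm_mul, Complex.norm_real]
    exact mul_le_mul k2 k3 (norm_nonneg _) (by positivity)
  have m2 : ‖((∏' k, f' k : ℝ) : ℂ) * (∏ k ∈ Finset.range g, u k - ∏' k, f k)‖
      ≤ B' * (B * (e * S + ∑' k, b (k + g))) := by
    rw [norm_mul, Complex.norm_real]
    exact mul_le_mul k4 k1 (norm_nonneg _) hB'.le
  rw [hdiff, norm_mul, hc]
  have m3 : B' * (e' * S + ∑' k, b' (k + g)) * B + B' * (B * (e * S + ∑' k, b (k + g)))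
      ≤ B' * B * (e + e' + 1) * (S + (∑' k, b' (k + g) + ∑' k, b (k + g))) := by
    have : 0 ≤ B' * B * (S + (e + e') * (∑' k, b' (k + g) + ∑' k, b (k + g))) := by positivity
    linarith
  calc _ ≤ |p / m| * (2 * √(lam 0)) *
        (B' * B * (e + e' + 1) * (S + (∑' k, b' (k + g) + ∑' k, b (k + g)))) :=
        mul_le_mul_of_nonneg_left ((norm_add_le _ _).trans ((add_le_add m1 m2).trans m3))
          (by positivity)
    _ = _ := by ring

theorem sum_Icc_le_tsum {d : ℕ → ℝ} (hd : Summable d) (hd0 : ∀ k, 0 ≤ d k) (g g' : ℕ) :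
    ∑ k ∈ Finset.Icc (g + 1) g', d k ≤ ∑' k, d (k + (g + 1)) := by
  have e : Finset.Icc (g + 1) g' = Finset.Ico (g + 1) (g' + 1) := by
    ext k
    simp only [Finset.mem_Icc, Finset.mem_Ico]
    omega
  rw [e, Finset.sum_Ico_eq_sum_range]
  simp only [add_comm (g + 1)]
  exact ((summable_nat_add_iff (g + 1)).2 hd).sum_le_tsum _ fun k _ => hd0 _

/-- The poles converge as the number of gaps grows, with a rate which is uniform in the
coefficients. -/
theorem exists_pole_limit (h : Admissible lam lamStar) (hC : GapBounds lam C) (hδ : 0 < δ)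
    (hδΔ : δ ≤ Δ) :
    ∃ K, ∀ (p M : ℝ → ℝ), MemE2 δ Δ p M → ∀ (θ₀ : ℕ → ℝ) (θ : ℕ → ℕ → ℝ → ℝ),
      (∀ g, IsPoleMotion lam g p M θ₀ (θ g)) → ∀ i, 1 ≤ i → ∀ x, ∃ l,
        Tendsto (fun g => pole lam i (θ g i x)) atTop (𝓝 l) ∧
        (lam (2 * i - 1) ≤ l ∧ l ≤ lam (2 * i)) ∧
        ∀ g, i ∈ Finset.Icc 1 g → |pole lam i (θ g i x) - l| ≤
          √(gapLen lam i) * ((∑' k, gapLen lam (k + (g + 1))) * Real.exp (K * |x|)) := by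
  obtain ⟨K, hK⟩ := exists_abs_pole_sub_le hC h.le_lamStar hδ hδΔ
  refine ⟨K, fun p M hE θ₀ θ hθ i hi x => ?_⟩
  have hd := h.summable_gapLen
  have hd0 := gapLen_nonneg h.strictMono
  let τ : ℕ → ℝ := fun g =>
    √(gapLen lam i) * ((∑' k, gapLen lam (k + (g + 1))) * Real.exp (K * |x|))
  have hτ : Tendsto τ atTop (𝓝 0) := by
    have h1 := (tendsto_add_atTop_iff_nat 1).2 (tendsto_sum_nat_add (gapLen lam))
    simpa [τ] using (h1.mul_const (Real.exp (K * |x|))).const_mul √(gapLen lam i)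
  have hcmp : ∀ g g', i ∈ Finset.Icc 1 g → g ≤ g' →
      |pole lam i (θ g i x) - pole lam i (θ g' i x)| ≤ τ g := fun g g' hg hgg =>
    (hK p M hE g g' θ₀ (θ g) (θ g') hgg (hθ g) (hθ g') i hg x).trans
      (mul_le_mul_of_nonneg_left (mul_le_mul_of_nonneg_right (sum_Icc_le_tsum hd hd0 g g')
        (Real.exp_pos _).le) (Real.sqrt_nonneg _))
  have hcau : CauchySeq fun g => pole lam i (θ g i x) := by
    rw [Metric.cauchySeq_iff']
    intro ε hε
    obtain ⟨N, hN, hNi⟩ := ((hτ.eventually_lt_const hε).and (eventually_ge_atTop i)).exists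
    refine ⟨N, fun n hn => ?_⟩
    rw [dist_comm, Real.dist_eq]
    exact (hcmp N n (Finset.mem_Icc.2 ⟨hi, hNi⟩) hn).trans_lt hN
  obtain ⟨l, hl⟩ := cauchySeq_tendsto_of_complete hcau
  refine ⟨l, hl, ⟨ge_of_tendsto' hl fun g => (pole_mem_gap h.strictMono i _).1,
    le_of_tendsto' hl fun g => (pole_mem_gap h.strictMono i _).2⟩, fun g hg => ?_⟩
  exact le_of_tendsto (hl.const_sub _).abs
    ((eventually_ge_atTop g).mono fun g' hgg => hcmp g g' hg hgg)

theorem hasDerivAt_coeff {p m : ℝ → ℝ} {x : ℝ} (c : ℝ) (hp : DifferentiableAt ℝ p x)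
    (hm : DifferentiableAt ℝ m x) (hp0 : p x ≠ 0) (hm0 : m x ≠ 0) :
    HasDerivAt (fun s => c * p s / m s)
      (c * (p x / m x * (deriv p x / p x - deriv m x / m x))) x := by
  refine ((hp.hasDerivAt.const_mul c).div hm.hasDerivAt hm0).congr_deriv ?_
  field_simp

/-- The bound for the derivative of `U_g`, in terms of the velocities of the poles. -/
theorem exists_hasDerivAt_Ug (h : Admissible lam lamStar) {r : ℝ} (hr : 0 < r) {B α V : ℝ}
    (hB : 0 ≤ B) (hα : 0 ≤ α) (hV : 0 ≤ V) :
    ∃ D, ∀ (g : ℕ) (p m : ℝ → ℝ) (P : ℕ → ℝ → ℝ) (x : ℝ) (z : ℂ),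
      DifferentiableAt ℝ p x → DifferentiableAt ℝ m x → p x ≠ 0 → m x ≠ 0 → |p x / m x| ≤ B →
      |deriv p x / p x - deriv m x / m x| ≤ α → InGaps lam (fun i => P i x) →
      (∀ i ∈ Finset.Icc 1 g, ∃ v, HasDerivAt (P i) v x ∧ |v| ≤ V * gapLen lam i) →
      r ≤ ‖z - (lamStar : ℂ)‖ →
      ∃ u, HasDerivAt (fun s => Ug lam lamStar g (p s) (m s) (fun i => P i s) z) u x ∧
        ‖u‖ ≤ D := by
  obtain ⟨C, hC⟩ := h.exists_gapBounds
  obtain ⟨a, e, ha0, ha, he, hae⟩ := exists_factor_bounds h hr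
  have hC0 := hC.nonneg
  set e' : ℝ := Real.exp (C * (C * C)) * C with he'def
  have he' : 0 ≤ e' := by positivity
  let a' : ℕ → ℝ := fun i => e' * gapLen lam i
  have ha' : Summable a' := h.summable_gapLen.mul_left e'
  have ha0' : ∀ i, 0 ≤ a' i := fun i => mul_nonneg he' (gapLen_nonneg h.strictMono _)
  set A := Real.exp (∑' k, a k)
  set A' := Real.exp (∑' k, a' k)
  have hA : 0 < A := Real.exp_pos _
  have hA' : 0 < A' := Real.exp_pos _
  set c : ℝ := 2 * √(lam 0) with hcdef
  have hc : 0 ≤ c := by positivity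
  set W : ℝ := V * (C * C) with hWdef
  have hW : 0 ≤ W := by positivity
  refine ⟨(c * (B * α) * A' + c * B * (A' * (e' * W))) * A + c * B * A' * (A * (e * W)), ?_⟩
  intro g p m P x z hp hm hp0 hm0 hpm hlog hP hv hz
  choose! v hv hvb using hv
  have hsumV : ∑ i ∈ Finset.Icc 1 g, |v i| ≤ W := by
    refine (Finset.sum_le_sum hvb).trans ?_
    rw [← Finset.mul_sum]
    exact mul_le_mul_of_nonneg_left (hC.sum_gapLen_le fun k hk => (Finset.mem_Icc.1 hk).1) hV
  have hi1 : ∀ i ∈ Finset.Icc 1 g, 1 ≤ i := fun i hi => (Finset.mem_Icc.1 hi).1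
  have hcoef := hasDerivAt_coeff (-2 * √(lam 0)) hp hm hp0 hm0
  have hroot : ∀ i ∈ Finset.Icc 1 g, HasDerivAt (fun s => rootRatio lam i (P i s))
      (-(rootRatio lam i (P i x) * (v i / P i x))) x := by
    intro i hi
    have hpos : P i x ≠ 0 := ((hC.lam_pos (2 * i - 1)).trans_le (hP i (hi1 i hi)).1).ne'
    unfold rootRatio
    refine ((hasDerivAt_const x _).div (hv i hi) hpos).congr_deriv ?_
    field_simp
    ring
  have hrootb : ∀ i ∈ Finset.Icc 1 g, ‖-(rootRatio lam i (P i x) * (v i / P i x))‖ ≤ e' * |v i| := by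
    intro i hi
    have hpos : 0 < P i x := (hC.lam_pos (2 * i - 1)).trans_le (hP i (hi1 i hi)).1
    have h0 : lam 0 ≤ P i x :=
      (hC.strictMono.monotone (Nat.zero_le (2 * i - 1))).trans (hP i (hi1 i hi)).1
    have h1 : 1 / P i x ≤ C := (one_div_le_one_div_of_le hC.pos h0).trans hC.inv_zero
    have h2 : |rootRatio lam i (P i x)| ≤ Real.exp (C * (C * C)) := by
      rw [rootRatio_eq_exp hC i hpos, Real.abs_exp, Real.exp_le_exp]
      linarith [(abs_le.1 (abs_soloLog_le_const hC (hi1 i hi) (hP i (hi1 i hi)))).1]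
    rw [norm_neg, norm_mul, Real.norm_eq_abs, Real.norm_eq_abs, abs_div, abs_of_pos hpos,
      div_eq_mul_one_div, he'def, mul_assoc, mul_comm |v i|]
    exact mul_le_mul h2 (mul_le_mul_of_nonneg_right h1 (abs_nonneg _)) (by positivity)
      (Real.exp_pos _).le
  obtain ⟨R', hR', hR'b⟩ := exists_hasDerivAt_prod hroot (a := a') fun i hi =>
    abs_rootRatio_sub_one_le hC (hi1 i hi) (hP i (hi1 i hi))
  have hfac : ∀ i ∈ Finset.Icc 1 g, HasDerivAt (fun s => factor lam lamStar i (P i s) z)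
      (-(v i : ℂ) * (E i (((lamStar : ℂ) - (lam (2 * i) : ℂ)) / ((lamStar : ℂ) - z)) /
        (z - (lamStar : ℂ)))) x := by
    intro i hi
    simp only [factor_eq]
    exact ((hv i hi).ofReal_comp.const_sub z).mul_const _
  obtain ⟨F', hF', hF'b⟩ := exists_hasDerivAt_prod hfac (a := a) fun i hi =>
    (hae i z hz).2 _ (hP i (hi1 i hi))
  have hsumA : Real.exp (∑ i ∈ Finset.Icc 1 g, a i) ≤ A :=
    Real.exp_le_exp.2 (ha.sum_le_tsum _ fun k _ => ha0 k)
  have hsumA' : Real.exp (∑ i ∈ Finset.Icc 1 g, a' i) ≤ A' :=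
    Real.exp_le_exp.2 (ha'.sum_le_tsum _ fun k _ => ha0' k)
  have nR : ‖((∏ i ∈ Finset.Icc 1 g, rootRatio lam i (P i x) : ℝ) : ℂ)‖ ≤ A' := by
    rw [Complex.norm_real]
    exact (norm_prod_le_exp (a := a') fun i hi =>
      abs_rootRatio_sub_one_le hC (hi1 i hi) (hP i (hi1 i hi))).trans hsumA'
  have nF : ‖∏ i ∈ Finset.Icc 1 g, factor lam lamStar i (P i x) z‖ ≤ A :=
    (norm_prod_le_exp fun i hi => (hae i z hz).2 _ (hP i (hi1 i hi))).trans hsumA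
  have nR' : ‖(R' : ℂ)‖ ≤ A' * (e' * W) := by
    rw [Complex.norm_real]
    refine hR'b.trans (mul_le_mul hsumA' ?_ (Finset.sum_nonneg fun i _ => norm_nonneg _) hA'.le)
    refine (Finset.sum_le_sum hrootb).trans ?_
    rw [← Finset.mul_sum]
    exact mul_le_mul_of_nonneg_left hsumV he'
  have nF' : ‖F'‖ ≤ A * (e * W) := by
    refine hF'b.trans (mul_le_mul hsumA ?_ (Finset.sum_nonneg fun i _ => norm_nonneg _) hA.le)
    refine le_trans (Finset.sum_le_sum (g := fun i => e * |v i|) fun i hi => ?_) ?_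
    · rw [norm_mul, norm_neg, Complex.norm_real, Real.norm_eq_abs, mul_comm]
      exact mul_le_mul_of_nonneg_right (hae i z hz).1 (abs_nonneg _)
    · rw [← Finset.mul_sum]
      exact mul_le_mul_of_nonneg_left hsumV he
  have nc : ‖((-2 * √(lam 0) * p x / m x : ℝ) : ℂ)‖ ≤ c * B := by
    rw [Complex.norm_real, Real.norm_eq_abs,
      show -2 * √(lam 0) * p x / m x = -(c * (p x / m x)) by rw [hcdef]; ring, abs_neg, abs_mul,
      abs_of_nonneg hc]
    exact mul_le_mul_of_nonneg_left hpm hc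
  have nc' : ‖((-2 * √(lam 0) * (p x / m x * (deriv p x / p x - deriv m x / m x)) : ℝ) : ℂ)‖
      ≤ c * (B * α) := by
    rw [Complex.norm_real, Real.norm_eq_abs, abs_mul, abs_mul (p x / m x),
      show -2 * √(lam 0) = -c by rw [hcdef]; ring, abs_neg, abs_of_nonneg hc]
    exact mul_le_mul_of_nonneg_left (mul_le_mul hpm hlog (abs_nonneg _) hB) hc
  refine ⟨_, (((hcoef.ofReal_comp.mul hR'.ofReal_comp).mul hF').congr_of_eventuallyEq
    (Eventually.of_forall fun s => Ug_eq hC g (p s) (m s) (fun i => P i s) z)), ?_⟩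
  refine (norm_add_le _ _).trans (add_le_add ?_ ?_)
  · rw [norm_mul]
    refine mul_le_mul ((norm_add_le _ _).trans (add_le_add ?_ ?_)) nF (norm_nonneg _)
      (by positivity)
    · rw [norm_mul]
      exact mul_le_mul nc' nR (norm_nonneg _) (by positivity)
    · rw [norm_mul]
      exact mul_le_mul nc nR' (norm_nonneg _) (by positivity)
  · rw [norm_mul]
    refine mul_le_mul ?_ nF' (norm_nonneg _) (by positivity)
    rw [Pi.mul_apply, norm_mul]
    exact mul_le_mul nc nR (norm_nonneg _) (by positivity)

theorem exists_pos_le_norm_sub {K : Set ℂ} (hK : IsCompact K) {w : ℂ} (hw : w ∉ K) :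
    ∃ r, 0 < r ∧ ∀ z ∈ K, r ≤ ‖z - w‖ := by
  obtain ⟨r, hr, hball⟩ := Metric.isOpen_iff.1 hK.isClosed.isOpen_compl w hw
  refine ⟨r, hr, fun z hz => ?_⟩
  by_contra hlt
  exact hball (by rw [Metric.mem_ball, dist_eq_norm]; exact not_le.1 hlt) hz

end

end SL

theorem mainTheorem2
    -- the spectral parameters
    (lam : ℕ → ℝ) (lamStar : ℝ) (hlam : SL.Admissible lam lamStar)
    -- the family `(p(t, ·), 𝓜(t, ·))`
    (δ Δ : ℝ) (hδ : 0 < δ) (p M : ℝ → ℝ → ℝ) (hE2 : ∀ t, SL.MemE2 δ Δ (p t) (M t))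
    (hp_bdd : ∃ B : ℝ, ∀ t x, p t x ≤ B)
    (hp_diff : ∀ t, Differentiable ℝ (p t)) (hM_diff : ∀ t, Differentiable ℝ (M t))
    (hα : ∃ α : ℝ, ∀ t x, |deriv (p t) x / p t x - deriv (M t) x / M t x| ≤ α)
    -- the pole motions: `θ g i t x` is the angle of the `i`-th of the `g` poles at `(t, x)`
    (θ₀ : ℕ → ℝ → ℝ) (θ : ℕ → ℕ → ℝ → ℝ → ℝ)
    (hθ : ∀ g t, SL.IsPoleMotion lam g (p t) (M t) (fun i => θ₀ i t) (fun i => θ g i t)) :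
    -- the `x`-derivatives of `U_g` are bounded, uniformly in `g`, `t`, `x` and `z ∈ K`
    (∀ K : Set ℂ, IsCompact K → (lamStar : ℂ) ∉ K →
      ∃ C : ℝ, ∀ (g : ℕ) (t x : ℝ), ∀ z ∈ K,
        DifferentiableAt ℝ (fun s : ℝ => SL.Ug lam lamStar g (p t s) (M t s)
          (fun i => SL.pole lam i (θ g i t s)) z) x ∧
        ‖deriv (fun s : ℝ => SL.Ug lam lamStar g (p t s) (M t s)
          (fun i => SL.pole lam i (θ g i t s)) z) x‖ ≤ C) ∧
    -- the poles have limits `P i t x`, the infinite products which define `U` converge, and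
    -- `U_g → U` uniformly in `t ∈ ℝ`, `x ∈ X` and `z ∈ K`
    ∃ P : ℕ → ℝ → ℝ → ℝ,
      (∀ i : ℕ, 1 ≤ i → ∀ t x : ℝ,
        Filter.Tendsto (fun g : ℕ => SL.pole lam i (θ g i t x)) Filter.atTop (nhds (P i t x))) ∧
      (∀ t x : ℝ,
        Multipliable fun k : ℕ =>
          √(lam (2 * (k + 1) - 1) * lam (2 * (k + 1))) / P (k + 1) t x) ∧
      (∀ t x : ℝ, ∀ z : ℂ, z ≠ (lamStar : ℂ) →
        Multipliable fun i : ℕ => SL.factor lam lamStar (i + 1) (P (i + 1) t x) z) ∧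
      ∀ K : Set ℂ, IsCompact K → (lamStar : ℂ) ∉ K → ∀ X : Set ℝ, IsCompact X →
        TendstoUniformlyOn
          (fun (g : ℕ) (w : ℝ × ℝ × ℂ) =>
            SL.Ug lam lamStar g (p w.1 w.2.1) (M w.1 w.2.1)
              (fun i => SL.pole lam i (θ g i w.1 w.2.1)) w.2.2)
          (fun w : ℝ × ℝ × ℂ =>
            SL.Ulim lam lamStar (p w.1 w.2.1) (M w.1 w.2.1) (fun i => P i w.1 w.2.1) w.2.2)
          Filter.atTop (Set.univ ×ˢ X ×ˢ K) := by

  have hδΔ : δ ≤ Δ := ((hE2 0).M_lower 0).trans ((hE2 0).M_upper 0)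
  obtain ⟨C, hC⟩ := hlam.exists_gapBounds
  obtain ⟨B, hB⟩ := hp_bdd
  have hp_pos : ∀ t x, 0 < p t x := fun t x => hδ.trans_le ((hE2 t).p_lower x)
  have hM_pos : ∀ t x, 0 < M t x := fun t x => hδ.trans_le ((hE2 t).M_lower x)
  have hB0 : 0 ≤ B := (hp_pos 0 0).le.trans (hB 0 0)
  have hpM : ∀ t x, |p t x / M t x| ≤ B / δ := fun t x => by
    rw [abs_of_nonneg (div_nonneg (hp_pos t x).le (hM_pos t x).le)]
    exact div_le_div₀ hB0 (hB t x) hδ ((hE2 t).M_lower x)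
  have hBδ : 0 ≤ B / δ := div_nonneg hB0 hδ.le
  refine ⟨fun K hK hKs => ?_, ?_⟩
  · obtain ⟨α, hα⟩ := hα
    obtain ⟨r, hr, hrK⟩ := SL.exists_pos_le_norm_sub hK hKs
    obtain ⟨V, hV, hVb⟩ := SL.exists_abs_deriv_pole_le hC hlam.le_lamStar hδ hδΔ
    obtain ⟨D, hD⟩ := SL.exists_hasDerivAt_Ug hlam hr hBδ ((abs_nonneg _).trans (hα 0 0)) hV
    refine ⟨D, fun g t x z hz => ?_⟩
    obtain ⟨u, hu, hub⟩ := hD g (p t) (M t) (fun i s => SL.pole lam i (θ g i t s)) x z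
      (hp_diff t x) (hM_diff t x) (hp_pos t x).ne' (hM_pos t x).ne' (hpM t x) (hα t x)
      (SL.inGaps_pole hlam.strictMono _)
      (fun i hi => hVb (p t) (M t) (hE2 t) g _ _ (hθ g t) i hi x) (hrK z hz)
    exact ⟨hu.differentiableAt, by rwa [hu.deriv]⟩
  · obtain ⟨κ, hκ⟩ := SL.exists_pole_limit hlam hC hδ hδΔ
    have hlim := fun (i : ℕ) (hi : 1 ≤ i) (t x : ℝ) =>
      hκ (p t) (M t) (hE2 t) (fun i => θ₀ i t) (fun g i => θ g i t) (fun g => hθ g t) i hi x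
    choose! P hP hPgap hPrate using hlim
    have hPin : ∀ t x, SL.InGaps lam (fun i => P i t x) := fun t x i hi => hPgap i hi t x
    refine ⟨P, hP, fun t x => SL.multipliable_rootRatio hlam (hPin t x),
      fun t x z hz => SL.multipliable_factor hlam (hPin t x) hz, ?_⟩
    intro K hK hKs X hX
    obtain ⟨r, hr, hrK⟩ := SL.exists_pos_le_norm_sub hK hKs
    obtain ⟨W, ε, hW, hε0, hε, hUW⟩ := SL.exists_norm_Ug_sub_Ulim_le hlam hr
    obtain ⟨ρ, hρ⟩ := hX.isBounded.exists_norm_le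
    set τ : ℕ → ℝ := fun g => ∑' k, SL.gapLen lam (k + (g + 1)) with hτdef
    have hτ0 : ∀ g, 0 ≤ τ g := fun g => tsum_nonneg fun k => SL.gapLen_nonneg hlam.strictMono _
    have hτ : Filter.Tendsto τ Filter.atTop (nhds 0) :=
      (Filter.tendsto_add_atTop_iff_nat 1).2 (tendsto_sum_nat_add (SL.gapLen lam))
    have hbound : Filter.Tendsto
        (fun g => B / δ * W * (C * (τ g * Real.exp (|κ| * ρ)) + ε g)) Filter.atTop (nhds 0) := by
      simpa using (((hτ.mul_const (Real.exp (|κ| * ρ))).const_mul C).add hε).const_mul (B / δ * W)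
    rw [Metric.tendstoUniformlyOn_iff]
    intro η hη
    filter_upwards [hbound.eventually_lt_const hη] with g hg
    rintro ⟨t, x, z⟩ ⟨-, hx, hz⟩
    rw [dist_comm, dist_eq_norm]
    have hsum : ∑ k ∈ Finset.range g, |SL.pole lam (k + 1) (θ g (k + 1) t x) - P (k + 1) t x|
        ≤ C * (τ g * Real.exp (|κ| * ρ)) := by
      have hexp : Real.exp (κ * |x|) ≤ Real.exp (|κ| * ρ) :=
        Real.exp_le_exp.2 (mul_le_mul (le_abs_self _) (hρ x hx) (abs_nonneg _) (abs_nonneg _))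
      calc _ ≤ ∑ k ∈ Finset.range g,
            √(SL.gapLen lam (k + 1)) * (τ g * Real.exp (|κ| * ρ)) := by
            refine Finset.sum_le_sum fun k hk => ?_
            have hk' := Finset.mem_range.1 hk
            exact (hPrate (k + 1) (by omega) t x g (Finset.mem_Icc.2 ⟨by omega, by omega⟩)).trans
              (mul_le_mul_of_nonneg_left (mul_le_mul_of_nonneg_left hexp (hτ0 g))
                (Real.sqrt_nonneg _))
        _ = (∑ k ∈ (Finset.range g).map (addRightEmbedding 1), √(SL.gapLen lam k)) *
              (τ g * Real.exp (|κ| * ρ)) := by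
            rw [Finset.sum_map, Finset.sum_mul]
            rfl
        _ ≤ _ := by
            refine mul_le_mul_of_nonneg_right (hC.sum_sqrt _ fun k hk => ?_)
              (mul_nonneg (hτ0 g) (Real.exp_pos _).le)
            obtain ⟨j, -, rfl⟩ := Finset.mem_map.1 hk
            exact Nat.le_add_left 1 j
    refine lt_of_le_of_lt ((hUW g (p t x) (M t x) (fun i => SL.pole lam i (θ g i t x))
      (fun i => P i t x) z (SL.inGaps_pole hlam.strictMono _) (hPin t x) (hrK z hz)).trans ?_) hg
    exact mul_le_mul (mul_le_mul_of_nonneg_right (hpM t x) hW) (add_le_add_left hsum _)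
      (add_nonneg (Finset.sum_nonneg fun k _ => abs_nonneg _) (hε0 g)) (mul_nonneg hBδ hW)
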